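/- Let $\mathbb R^4_1$ be $\mathbb R^4$ with $\langle x,y\rangle=-x_0y_0+x_1y_1+x_2y_2+x_3y_3$, put $\|x\|=\sqrt{|\langle x,x\rangle|}$, let $x\wedge y\wedge z$ be the pseudo vector product (the formal determinant with first row $(-e_0,e_1,e_2,e_3)$ and further rows $x,y,z$), $S^3_1=\{x:\langle x,x\rangle=1\}$ and $HP(v,c)=\{x:\langle x,v\rangle=c\}$. Let $X:U\to\mathbb R^4_1$ be a smooth spacelike embedding of an open set $U\subset\mathbb R^3$ (all nonzero tangent vectors of $M=X(U)$ are spacelike), with unit timelike normal $n=X_{u_1}\wedge X_{u_2}\wedge X_{u_3}/\|X_{u_1}\wedge X_{u_2}\wedge X_{u_3}\|$. Let $I\subset\mathbb R$ be an open interval, $\bar\gamma:I\to U$ smooth, and $\gamma=X\circ\bar\gamma$ of unit speed. Put $t=\gamma'$, $n_\gamma=n\circ\gamma$, $k_n=-\langle n_\gamma,t'\rangle$, $k_g=\|\langle n_\gamma,t'\rangle n_\gamma+t'\|$, and, where $k_g\ne0$, $n_1=(\langle n_\gamma,t'\rangle n_\gamma+t')/k_g$, $n_2=n_\gamma\wedge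 t\wedge n_1$, $\tau_1=\langle n_1,n_\gamma'\rangle$, $\tau_2=\langle n_2,n_\gamma'\rangle$, $\tau_g=\langle -n_2',n_1\rangle$, $\lambda_0=k_gk_n'+k_g^2\tau_1-k_n^2\tau_1-k_nk_g'$. Assume that on $I$ $$k_g\neq0,\qquad k_n\tau_2+k_g\tau_g\ne0,\qquad k_n^2>k_g^2 .$$ The de Sitter surface of $\gamma$ is $$DS_\gamma(s,\theta)=\frac{\cos\theta}{\sqrt{k_n^2(s)-k_g^2(s)}}\bigl(k_g(s)n_\gamma(s)+k_n(s)n_1(s)\bigr)+\sin\theta\, n_2(s),$$ and a de Sitter curve of $\gamma$ is a continuous curve $DC_\gamma(s)=DS_\gamma(s,\theta(s))$, $s\in I$, with $\cos\theta(s)\neq0$ and $\tan\theta(s)=\dfrac{\lambda_0(s)}{(k_n\tau_2+k_g\tau_g)(s)\sqrt{k_n^2(s)-k_g^2(s)}}$. For $v\in S^3_1$ put $(h^S_t)_v(s)=\langle t(s),v\rangle$. A function $g$ has an $A_k$-singularity at $s_0$ if $g(s_0)=g'(s_0)=\dots=g^{(k)}(s_0)=0\ne g^{(k+1)}(s_0)$,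 and an $A_{\ge k}$-singularity if $g(s_0)=\dots=g^{(k)}(s_0)=0$. The curve $\gamma$ and the slice $M\cap HP(v,c)$ (with $v\neq0$) have contact of order $k$ (of order at least $k$) at $s_0$ if $s\mapsto\langle\gamma(s),v\rangle-c$ has an $A_k$-singularity (an $A_{\ge k}$-singularity) at $s_0$. A curve $\alpha:I\to S^3_1$ is at $s_0$ locally diffeomorphic to a curve $\beta:\mathbb R\to\mathbb R^3$ (at $\beta(0)$) if there are smooth diffeomorphisms $\varphi$ from an open neighbourhood $J\subset I$ of $s_0$ onto an open neighbourhood of $0$, $\varphi(s_0)=0$, and $\Phi$ from an open subset of $S^3_1$ containing $\alpha(J)$ onto an open set $W\subset\mathbb R^3$, with $\Phi\circ\alpha=\beta\circ\varphi$ on $J$ and $\Phi(\alpha(J))=\beta(\mathbb R)\cap W$. Let $s_0\in I$, $\theta_0\in\mathbb R$, $v_0=DS_\gamma(s_0,\theta_0)$ and $c=\langle\gamma(s_0),v_0\rangle$. Then $v_0\in S^3_1$ (so that $M\cap HP(v_0,c)$ is a timelike slice), and: (1) $\gamma$ and $M\cap HP(v_0,c)$ have contact of order at least $3$ at $s_0$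 if and only if $(h^S_t)_{v_0}$ has an $A_{\ge2}$-singularity at $s_0$; likewise, they have contact of some finite order $k\ge3$ if and only if $(h^S_t)_{v_0}$ has an $A_k$-singularity at $s_0$ for some finite $k\ge2$. If the contact at $s_0$ is of order exactly $3$, then every de Sitter curve $DC_\gamma$ of $\gamma$ is, at $s_0$, locally diffeomorphic to a line. (2) $\gamma$ and $M\cap HP(v_0,c)$ have contact of order exactly $4$ at $s_0$ if and only if $(h^S_t)_{v_0}$ has an $A_3$-singularity at $s_0$. In this case, if $\lambda_0(s_0)\neq0$, then every de Sitter curve $DC_\gamma$ of $\gamma$ is, at $s_0$, locally diffeomorphic to the $(2,3,4)$-cusp $x\mapsto(x^2,x^3,x^4)$. -/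

import Mathlib

open Set Topology
open scoped ContDiff

noncomputable section

namespace Mink

/-- The underlying vector space of Minkowski `4`-space; coordinates are `x 0, x 1, x 2, x 3`. -/
abbrev R4 : Type := Fin 4 → ℝ

/-- The parameter space `ℝ³`. -/
abbrev R3 : Type := Fin 3 → ℝ

/-- The pseudo-scalar product `-x₀y₀ + x₁y₁ + x₂y₂ + x₃y₃`. -/
def mink (x y : R4) : ℝ := -(x 0 * y 0) + x 1 * y 1 + x 2 * y 2 + x 3 * y 3

/-- `‖x‖ = √|⟨x, x⟩|`. -/
def mnorm (x : R4) : ℝ := Real.sqrt |mink x x|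

/-- The pseudo vector product `x ∧ y ∧ z`: the formal determinant with first row
`(-e₀, e₁, e₂, e₃)` and further rows `x, y, z`. Its `i`-th coordinate is obtained by taking the
`i`-th coordinates of `-e₀, e₁, e₂, e₃` as the first row. -/
def wedge (x y z : R4) : R4 := fun i =>
  Matrix.det (Matrix.of ![fun j => if j = i then (if i = 0 then -1 else 1) else 0, x, y, z])

/-- The hyperplane `HP(v, c)` with pseudo-normal `v`. -/
def hyperplane (v : R4) (c : ℝ) : Set R4 := {x | mink x v = c}

/-- The de Sitter `3`-space. -/
def deSitter : Set R4 := {x | mink x x = 1}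

/-! ### Curves in a spacelike hypersurface -/

/-- `X : U → ℝ⁴₁` is a (smooth) spacelike embedding of the open set `U ⊆ ℝ³`: it is smooth, a
homeomorphism onto its image, and every non-zero tangent vector of the image is spacelike (so
that in particular `X` is an immersion). -/
structure IsSpacelikeEmbedding (U : Set R3) (X : R3 → R4) : Prop where
  isOpen : IsOpen U
  contDiffOn : ContDiffOn ℝ ∞ X U
  isEmbedding : IsEmbedding (U.domRestrict X)
  spacelike : ∀ u ∈ U, ∀ w : R3, w ≠ 0 → 0 < mink (fderiv ℝ X u w) (fderiv ℝ X u w)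

/-- The partial derivative `∂X/∂uᵢ`. -/
def partialX (X : R3 → R4) (i : Fin 3) (u : R3) : R4 := fderiv ℝ X u (Pi.single i 1)

/-- The unit timelike normal `X_{u₁} ∧ X_{u₂} ∧ X_{u₃} / ‖X_{u₁} ∧ X_{u₂} ∧ X_{u₃}‖`. It is future
or past directed according to the orientation of the parametrisation `X`; both are allowed. -/
def unitNormal (X : R3 → R4) (u : R3) : R4 :=
  (mnorm (wedge (partialX X 0 u) (partialX X 1 u) (partialX X 2 u)))⁻¹ •
    wedge (partialX X 0 u) (partialX X 1 u) (partialX X 2 u)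

section Frame

variable (X : R3 → R4) (γb : ℝ → R3)

/-- The curve `γ = X ∘ γ̄`. -/
def curve (s : ℝ) : R4 := X (γb s)

/-- The tangent vector `t(s) = γ'(s)`. -/
def tang : ℝ → R4 := deriv (curve X γb)

/-- The normal `n_γ` of the hypersurface along the curve. -/
def nG (s : ℝ) : R4 := unitNormal X (γb s)

/-- The vector `⟨n_γ, t'⟩ n_γ + t'`. -/
def geodVec (s : ℝ) : R4 :=
  mink (nG X γb s) (deriv (tang X γb) s) • nG X γb s + deriv (tang X γb) s

/-- The normal curvature `k_n = -⟨n_γ, t'⟩`. -/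
def kn (s : ℝ) : ℝ := -mink (nG X γb s) (deriv (tang X γb) s)

/-- The geodesic curvature `k_g = ‖⟨n_γ, t'⟩ n_γ + t'‖`. -/
def kg (s : ℝ) : ℝ := mnorm (geodVec X γb s)

/-- The first frame vector `n₁`, the normalisation of `⟨n_γ, t'⟩ n_γ + t'`. -/
def n1 (s : ℝ) : R4 := (kg X γb s)⁻¹ • geodVec X γb s

/-- The second frame vector `n₂ = n_γ ∧ t ∧ n₁`. -/
def n2 (s : ℝ) : R4 := wedge (nG X γb s) (tang X γb s) (n1 X γb s)

/-- The first normal torsion `τ₁ = ⟨n₁, n_γ'⟩`. -/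
def tau1 (s : ℝ) : ℝ := mink (n1 X γb s) (deriv (nG X γb) s)

/-- The second normal torsion `τ₂ = ⟨n₂, n_γ'⟩`. -/
def tau2 (s : ℝ) : ℝ := mink (n2 X γb s) (deriv (nG X γb) s)

/-- The geodesic torsion `τ_g = ⟨-n₂', n₁⟩`. -/
def taug (s : ℝ) : ℝ := mink (-deriv (n2 X γb) s) (n1 X γb s)

/-- The function `k_n τ₂ + k_g τ_g`. -/
def sigma (s : ℝ) : ℝ := kn X γb s * tau2 X γb s + kg X γb s * taug X γb s

/-- The function `λ₀ = k_g k_n' + k_g² τ₁ - k_n² τ₁ - k_n k_g'`. -/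
def lambda0 (s : ℝ) : ℝ :=
  kg X γb s * deriv (kn X γb) s + kg X γb s ^ 2 * tau1 X γb s
    - kn X γb s ^ 2 * tau1 X γb s - kn X γb s * deriv (kg X γb) s

/-- The spacelike tangential height function `(h^S_t)_v(s) = ⟨t(s), v⟩`. -/
def heightS (v : R4) (s : ℝ) : ℝ := mink (tang X γb s) v

/-- The de Sitter surface `DS_γ(s, θ)`; the angle `θ` may be any real number. -/
def deSitterSurface (s θ : ℝ) : R4 :=
  (Real.cos θ / Real.sqrt (kn X γb s ^ 2 - kg X γb s ^ 2)) •
      (kg X γb s • nG X γb s + kn X γb s • n1 X γb s)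
    + Real.sin θ • n2 X γb s

/-- The curve `s ↦ DS_γ(s, θ(s))`. -/
def deSitterCurve (θ : ℝ → ℝ) (s : ℝ) : R4 := deSitterSurface X γb s (θ s)

/-- `θ` is an angle function of the de Sitter curve over `I`:
`tan θ(s) = λ₀(s) / ((k_n τ₂ + k_g τ_g)(s) √(k_n² - k_g²)(s))` on `I`, and the resulting
`s ↦ DS_γ(s, θ(s))` is continuous. The equation fixes `θ(s)` modulo `π` only, so continuity says
that one does not jump between the two antipodal branches; `cos θ(s) ≠ 0` says that `tan θ(s)` is
defined. -/
structure IsDeSitterAngle (I : Set ℝ) (θ : ℝ → ℝ) : Prop where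
  cos_ne_zero : ∀ s ∈ I, Real.cos (θ s) ≠ 0
  tan_eq : ∀ s ∈ I, Real.tan (θ s) =
    lambda0 X γb s / (sigma X γb s * Real.sqrt (kn X γb s ^ 2 - kg X γb s ^ 2))
  continuousOn : ContinuousOn (deSitterCurve X γb θ) I

end Frame

/-! ### Singularity types and contact -/

/-- `g` has an `A_k`-singularity at `s₀`. -/
def HasASing (g : ℝ → ℝ) (s₀ : ℝ) (k : ℕ) : Prop :=
  (∀ j ≤ k, iteratedDeriv j g s₀ = 0) ∧ iteratedDeriv (k + 1) g s₀ ≠ 0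

/-- `g` has a singularity of type `A_{≥ k}` at `s₀`: `g(s₀) = g'(s₀) = ⋯ = g^{(k)}(s₀) = 0`. -/
def HasASingGE (g : ℝ → ℝ) (s₀ : ℝ) (k : ℕ) : Prop :=
  ∀ j ≤ k, iteratedDeriv j g s₀ = 0

/-- A smooth function on `ℝ⁴` which is a submersion. -/
def IsSubmersion (F : R4 → ℝ) : Prop :=
  ContDiff ℝ ∞ F ∧ ∀ x, Function.Surjective (fderiv ℝ F x)

/-- `γ` and `F⁻¹(0)` have contact of order (exactly) `k` at `s₀`, for a submersion `F`. -/
def HasContactOfOrder (F : R4 → ℝ) (γ : ℝ → R4) (s₀ : ℝ) (k : ℕ) : Prop :=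
  IsSubmersion F ∧ HasASing (F ∘ γ) s₀ k

/-- `γ` and `F⁻¹(0)` have contact of order at least `k` at `s₀`, for a submersion `F`. -/
def HasContactOfOrderGE (F : R4 → ℝ) (γ : ℝ → R4) (s₀ : ℝ) (k : ℕ) : Prop :=
  IsSubmersion F ∧ HasASingGE (F ∘ γ) s₀ k

/-- The defining function `x ↦ ⟨x, v⟩ - c` of the hyperplane `HP(v, c)`, and of the slices
`M ∩ HP(v, c)`. -/
def sliceFun (v : R4) (c : ℝ) (x : R4) : ℝ := mink x v - c

/-- The slice `M ∩ HP(v, c)` is the zero set of `sliceFun v c` on `M`. -/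
theorem slice_eq (M : Set R4) (v : R4) (c : ℝ) :
    M ∩ hyperplane v c = {x ∈ M | sliceFun v c x = 0} := by
  ext x
  simp [hyperplane, sliceFun, sub_eq_zero]

/-! ### Local diffeomorphism type of a curve in a hypersurface of `ℝ⁴` -/

/-- The curve `α : I → N ⊆ ℝ⁴` is, at `s₀`, locally diffeomorphic to the model curve `β` in `ℝ³`
at `β(0)`: there are a smooth diffeomorphism `φ` from an open neighbourhood of `s₀` in `I` to an
open neighbourhood of `0`, with `φ(s₀) = 0`, and a smooth diffeomorphism `f` (with inverse `g`)
from a relatively open subset `N ∩ V` of `N` to an open set `W ⊆ ℝ³`, such that `f ∘ α = β ∘ φ`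
near `s₀`, and such that `f` carries the piece of the trace of `α` onto `β(ℝ) ∩ W`. -/
def IsLocallyDiffeoToCurve (N : Set R4) (I : Set ℝ) (α : ℝ → R4) (s₀ : ℝ) (β : ℝ → R3) : Prop :=
  ∃ (φ : OpenPartialHomeomorph ℝ ℝ) (V : Set R4) (W : Set R3) (f : R4 → R3) (g : R3 → R4),
    s₀ ∈ φ.source ∧ φ.source ⊆ I ∧ φ s₀ = 0 ∧
    ContDiffOn ℝ ∞ φ φ.source ∧ ContDiffOn ℝ ∞ φ.symm φ.target ∧
    IsOpen V ∧ IsOpen W ∧ ContDiffOn ℝ ∞ f V ∧ ContDiffOn ℝ ∞ g W ∧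
    MapsTo f (N ∩ V) W ∧ MapsTo g W (N ∩ V) ∧ LeftInvOn g f (N ∩ V) ∧ RightInvOn g f W ∧
    MapsTo α φ.source (N ∩ V) ∧ (∀ s ∈ φ.source, f (α s) = β (φ s)) ∧
    f '' (α '' φ.source) = range β ∩ W

/-- A line in `ℝ³`. -/
def lineCurve (x : ℝ) : R3 := ![x, 0, 0]

/-- The parametrisation of the `(2,3,4)`-cusp `C(2,3,4)`. -/
def cusp234 (x : ℝ) : R3 := ![x ^ 2, x ^ 3, x ^ 4]

end Mink

end

/-!
Differentiating `s ↦ ⟨γ(s), v₀⟩ - c` gives the height function `⟨t(s), v₀⟩`, so contact orders and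
singularity types differ by one, and the equivalences follow.

For the local form of a de Sitter curve `α`, the point is that `α` is the dual curve of `t`: up to
sign it is the unit vector orthogonal to `t`, `t'` and `t''` (`exists_isDualCurve`, from the frame
equations of `IsAdaptedFrame`; the denominator `k_n τ₂ + k_g τ_g` makes `t, t', t''` independent).
If the height function has vanishing derivatives up to order two at `s₀`, then `v₀ = ± α(s₀)`, and
its next derivatives are `± ⟨α, t'''⟩` and `± ⟨α, t''''⟩`.

* If `⟨α, t'''⟩ ≠ 0`, then `⟨α', t''⟩ = -⟨α, t'''⟩ ≠ 0`, so `α` is regular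
  (`IsDualCurve.isLocallyDiffeo_lineCurve`).
* If `⟨α, t'''⟩ = 0 ≠ ⟨α, t''''⟩`, then `α' = 0`, and differentiating the orthogonality relations
  shows that `α''` and `α'''` are independent: `⟨α'', t''⟩ = -⟨α, t''''⟩`, `⟨α'', t'⟩ = 0` and
  `⟨α''', t'⟩ = 2 ⟨α, t''''⟩` (`IsDualCurve.isLocallyDiffeo_cusp234`).

Orthogonal projection along `α(s₀)` is a chart of the de Sitter space and turns `α` into a curve in
`ℝ³` (`isLocallyDiffeoToCurve_of_isGermEquivalent`). A curve with `c' = 0` and `c''`, `c'''`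
independent is equivalent to the `(2,3,4)`-cusp (`isGermEquivalent_cusp234`): no condition on the
fourth derivative is needed, since `(x², x³, x⁴)` and `(x², x³, 0)` differ by the diffeomorphism
which subtracts the square of the first coordinate from the last. The normal form rests on
Whitney's theorem that a smooth function of one variable can be written `A(x²) + x C(x²)` with
smooth `A` and `C` (`exists_eq_comp_sq_add_mul_comp_sq`), which is obtained from Borel's lemma.
-/

noncomputable section

namespace Mink

/-! ### Hadamard's lemma and Borel's lemma -/

/-- A set of functions stable under differentiation consists of smooth functions. -/
theorem contDiff_of_forall_exists_hasDerivAt (P : (ℝ → ℝ) → Prop)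
    (h : ∀ f, P f → ∃ f', P f' ∧ ∀ x, HasDerivAt f (f' x) x) (f : ℝ → ℝ) (hf : P f) :
    ContDiff ℝ ∞ f := by
  rw [contDiff_infty]
  intro n
  induction n generalizing f with
  | zero =>
    obtain ⟨f', -, hf'⟩ := h f hf
    exact contDiff_zero.2 (continuous_iff_continuousAt.2 fun x => (hf' x).continuousAt)
  | succ n ih =>
    obtain ⟨f', hP, hf'⟩ := h f hf
    have hd : deriv f = f' := funext fun x => (hf' x).deriv
    rw [show ((n + 1 : ℕ) : ℕ∞ω) = (n : ℕ∞ω) + 1 by push_cast; rfl, contDiff_succ_iff_deriv]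
    refine ⟨fun x => (hf' x).differentiableAt, ?_, ?_⟩
    · intro h0
      exact absurd h0 (by simp)
    · rw [hd]
      exact ih f' hP

theorem hasDerivAt_integral_pow_mul_comp_mul (m : ℕ) {f : ℝ → ℝ} (hf : ContDiff ℝ ∞ f) (x : ℝ) :
    HasDerivAt (fun x => ∫ t in (0 : ℝ)..1, t ^ m * f (t * x))
      (∫ t in (0 : ℝ)..1, t ^ (m + 1) * deriv f (t * x)) x := by
  have hc : Continuous f := hf.continuous
  have hd : Continuous (deriv f) := hf.continuous_deriv (by simp)
  obtain ⟨C, hC⟩ := (isCompact_closedBall (0 : ℝ) (|x| + 1)).exists_bound_of_continuousOn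
    hd.continuousOn
  refine (intervalIntegral.hasDerivAt_integral_of_dominated_loc_of_deriv_le
    (F := fun x t => t ^ m * f (t * x)) (F' := fun x t => t ^ (m + 1) * deriv f (t * x))
    (bound := fun _ => C) (Metric.ball_mem_nhds x one_pos) ?_ ?_ ?_ ?_ ?_ ?_).2
  · exact Filter.Eventually.of_forall fun y =>
      (by fun_prop : Continuous fun t => t ^ m * f (t * y)).aestronglyMeasurable
  · exact (by fun_prop : Continuous fun t => t ^ m * f (t * x)).intervalIntegrable _ _
  · exact (by fun_prop : Continuous fun t => t ^ (m + 1) * deriv f (t * x)).aestronglyMeasurable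
  · refine Filter.Eventually.of_forall fun t ht y hy => ?_
    rw [uIoc_of_le zero_le_one] at ht
    have hy' : |y| ≤ |x| + 1 := by
      have h1 : |y - x| < 1 := by simpa [Real.dist_eq] using hy
      have h2 := abs_add_le (y - x) x
      simp only [sub_add_cancel] at h2
      linarith
    have h1 : |t ^ (m + 1)| ≤ 1 := by
      rw [abs_of_nonneg (pow_nonneg ht.1.le _)]
      exact pow_le_one₀ ht.1.le ht.2
    have h2 : ‖deriv f (t * y)‖ ≤ C := by
      refine hC _ ?_
      rw [mem_closedBall_zero_iff, Real.norm_eq_abs, abs_mul, abs_of_pos ht.1]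
      nlinarith [abs_nonneg y, ht.2]
    rw [norm_mul, Real.norm_eq_abs]
    nlinarith [norm_nonneg (deriv f (t * y)), abs_nonneg (t ^ (m + 1))]
  · exact intervalIntegrable_const
  · refine Filter.Eventually.of_forall fun t _ y _ => ?_
    have h1 : HasDerivAt f (deriv f (t * y)) (t * y) :=
      (hf.differentiable (by simp) _).hasDerivAt
    have h2 : HasDerivAt (fun y => t * y) t y := by simpa using (hasDerivAt_id y).const_mul t
    exact ((h1.comp y h2).const_mul (t ^ m)).congr_deriv (by ring)

/-- **Hadamard's lemma** in one variable. -/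
theorem exists_contDiff_eq_add_mul {f : ℝ → ℝ} (hf : ContDiff ℝ ∞ f) :
    ∃ g : ℝ → ℝ, ContDiff ℝ ∞ g ∧ ∀ x, f x = f 0 + x * g x := by
  refine ⟨fun x => ∫ t in (0 : ℝ)..1, t ^ 0 * deriv f (t * x), ?_, fun x => ?_⟩
  · refine contDiff_of_forall_exists_hasDerivAt
      (fun F => ∃ m : ℕ, ∃ g : ℝ → ℝ, ContDiff ℝ ∞ g ∧
        F = fun x => ∫ t in (0 : ℝ)..1, t ^ m * g (t * x)) ?_ _
      ⟨0, deriv f, (contDiff_infty_iff_deriv.1 hf).2, rfl⟩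
    rintro F ⟨m, g, hg, rfl⟩
    exact ⟨_, ⟨m + 1, deriv g, (contDiff_infty_iff_deriv.1 hg).2, rfl⟩,
      hasDerivAt_integral_pow_mul_comp_mul m hg⟩
  · have h1 : ∀ t ∈ uIcc (0 : ℝ) 1, HasDerivAt (fun t => f (t * x)) (x * deriv f (t * x)) t := by
      intro t _
      have h1 : HasDerivAt f (deriv f (t * x)) (t * x) :=
        (hf.differentiable (by simp) _).hasDerivAt
      have h2 : HasDerivAt (fun t => t * x) x t := by simpa using (hasDerivAt_id t).mul_const x
      exact (h1.comp t h2).congr_deriv (by ring)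
    have hd : Continuous (deriv f) := hf.continuous_deriv (by simp)
    have h2 := intervalIntegral.integral_eq_sub_of_hasDerivAt h1
      ((by fun_prop : Continuous fun t => x * deriv f (t * x)).intervalIntegrable _ _)
    rw [intervalIntegral.integral_const_mul] at h2
    simp only [one_mul, zero_mul] at h2
    simp only [pow_zero, one_mul]
    linarith

/-- `f` has the Taylor series `∑ c k * x ^ k` at `0`, expressed through smooth remainders. -/
def HasTaylorCoeffs (f : ℝ → ℝ) (c : ℕ → ℝ) : Prop :=
  ∀ n : ℕ, ∃ R : ℝ → ℝ, ContDiff ℝ ∞ R ∧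
    ∀ x, f x = ∑ k ∈ Finset.range n, c k * x ^ k + x ^ n * R x

theorem hasTaylorCoeffs_of_tower {c : ℕ → ℝ} {T : ℕ → ℝ → ℝ} (hT : ∀ n, ContDiff ℝ ∞ (T n))
    (h : ∀ n x, T n x = c n + x * T (n + 1) x) : HasTaylorCoeffs (T 0) c := by
  intro n
  refine ⟨T n, hT n, fun x => ?_⟩
  induction n with
  | zero => simp
  | succ n ih =>
    rw [ih, h n x, Finset.sum_range_succ]
    ring

theorem exists_hasTaylorCoeffs {f : ℝ → ℝ} (hf : ContDiff ℝ ∞ f) : ∃ c, HasTaylorCoeffs f c := by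
  have H : ∀ f : {f : ℝ → ℝ // ContDiff ℝ ∞ f}, ∃ g : {f : ℝ → ℝ // ContDiff ℝ ∞ f},
      ∀ x, f.1 x = f.1 0 + x * g.1 x := fun f => by
    obtain ⟨g, hg, h⟩ := exists_contDiff_eq_add_mul f.2
    exact ⟨⟨g, hg⟩, h⟩
  choose S hS using H
  refine ⟨fun n => (S^[n] ⟨f, hf⟩).1 0,
    hasTaylorCoeffs_of_tower (T := fun n => (S^[n] ⟨f, hf⟩).1) (fun n => (S^[n] ⟨f, hf⟩).2)
      fun n x => ?_⟩
  simp only [Function.iterate_succ_apply']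
  exact hS _ x

/-- A smooth function vanishing near `0` is a smooth multiple of every power. -/
theorem exists_contDiff_eq_pow_mul {f : ℝ → ℝ} (hf : ContDiff ℝ ∞ f) (h0 : f =ᶠ[𝓝 0] 0) (n : ℕ) :
    ∃ e : ℝ → ℝ, ContDiff ℝ ∞ e ∧ ∀ x, f x = x ^ n * e x := by
  refine ⟨fun x => f x / x ^ n, contDiff_iff_contDiffAt.2 fun x => ?_, fun x => ?_⟩
  · rcases eq_or_ne x 0 with rfl | hx
    · refine (contDiffAt_const (c := (0 : ℝ))).congr_of_eventuallyEq ?_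
      filter_upwards [h0] with y hy
      simp [hy]
    · exact hf.contDiffAt.div (contDiffAt_id.pow n) (pow_ne_zero n hx)
  · rcases eq_or_ne x 0 with rfl | hx
    · simp [h0.self_of_nhds]
    · rw [mul_div_cancel₀ _ (pow_ne_zero n hx)]

/-- **Borel's lemma**: every real sequence is the Taylor series of a smooth function. -/
theorem exists_contDiff_hasTaylorCoeffs (c : ℕ → ℝ) :
    ∃ B : ℝ → ℝ, ContDiff ℝ ∞ B ∧ HasTaylorCoeffs B c := by
  let χ : ContDiffBump (0 : ℝ) := ⟨1, 2, one_pos, one_lt_two⟩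
  have hχ : ContDiff ℝ ∞ (χ : ℝ → ℝ) := χ.contDiff
  let g : ℕ → ℝ → ℝ := fun k x => x ^ k * χ x
  have hg : ∀ k, ContDiff ℝ ∞ (g k) := fun k => by
    have : ContDiff ℝ ∞ fun x : ℝ => x ^ k := by fun_prop
    exact this.mul hχ
  have hgc : ∀ k, HasCompactSupport (g k) := fun k => χ.hasCompactSupport.mul_left
  have hbd : ∀ j k : ℕ, ∃ C, ∀ x, ‖iteratedDeriv j (g k) x‖ ≤ C := fun j k => by
    obtain ⟨C, hC⟩ := ((hgc k).iteratedFDeriv (𝕜 := ℝ) j).exists_bound_of_continuous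
      ((hg k).continuous_iteratedFDeriv (m := j) (by exact_mod_cast le_top))
    exact ⟨C, fun x => by rw [← norm_iteratedFDeriv_eq_norm_iteratedDeriv]; exact hC x⟩
  choose C hC using hbd
  have hC0 : ∀ j k, 0 ≤ C j k := fun j k => (norm_nonneg _).trans (hC j k 0)
  let D : ℕ → ℝ := fun m => ∑ j ∈ Finset.range (m + 1), ∑ k ∈ Finset.range (m + 1), C j k
  have hD0 : ∀ m, 0 ≤ D m := fun m => Finset.sum_nonneg fun j _ => Finset.sum_nonneg fun k _ =>
    hC0 j k
  have hCD : ∀ j k m, j ≤ m → k ≤ m → C j k ≤ D m := fun j k m hj hk =>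
    (Finset.single_le_sum (f := fun k => C j k) (fun k _ => hC0 j k)
      (Finset.mem_range.2 (by omega : k < m + 1))).trans
    (Finset.single_le_sum (f := fun j => ∑ k ∈ Finset.range (m + 1), C j k)
      (fun j _ => Finset.sum_nonneg fun k _ => hC0 j k) (Finset.mem_range.2 (by omega : j < m + 1)))
  -- The scales shrink the supports fast enough to make all derived series converge.
  let l : ℕ → ℝ := fun m => 1 + 2 ^ m * |c m| * D m
  have hl : ∀ m, 1 ≤ l m := fun m => by
    have := mul_nonneg (mul_nonneg (pow_nonneg (zero_le_two : (0 : ℝ) ≤ 2) m) (abs_nonneg (c m)))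
      (hD0 m)
    simp only [l]; linarith
  let F : ℕ → ℕ → ℝ → ℝ := fun n k x => c (k + n) * (x ^ k * χ (l (k + n) * x))
  have hF : ∀ n k, F n k = fun x => (c (k + n) * (l (k + n))⁻¹ ^ k) * g k (l (k + n) * x) := by
    intro n k
    funext x
    have h0 : l (k + n) ≠ 0 := (one_pos.trans_le (hl _)).ne'
    simp only [F, g, mul_pow]
    have : (l (k + n))⁻¹ ^ k * l (k + n) ^ k = 1 := by rw [← mul_pow, inv_mul_cancel₀ h0, one_pow]
    linear_combination (-(c (k + n) * x ^ k * χ (l (k + n) * x))) * this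
  have hFs : ∀ n k, ContDiff ℝ ∞ (F n k) := fun n k => by
    rw [hF]
    exact contDiff_const.mul ((hg k).comp (contDiff_const.mul contDiff_id))
  have hFb : ∀ n j k x, j < k → ‖iteratedDeriv j (F n k) x‖ ≤ (1 / 2) ^ k := by
    intro n j k x hjk
    set m := k + n with hm
    have hgj : ContDiff ℝ j (g k) := (hg k).of_le (by exact_mod_cast le_top)
    have hl0 : 0 < l m := one_pos.trans_le (hl m)
    have hcomp : ContDiff ℝ j fun x => g k (l m * x) :=
      hgj.comp (contDiff_const.mul contDiff_id)
    rw [hF, iteratedDeriv_const_mul _ hcomp.contDiffAt, iteratedDeriv_comp_const_mul hgj]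
    rw [norm_mul, norm_mul, norm_mul, norm_pow, norm_pow, norm_inv, Real.norm_eq_abs,
      Real.norm_of_nonneg hl0.le]
    have h1 : (l m)⁻¹ ^ k * l m ^ j ≤ (l m)⁻¹ := by
      obtain ⟨i, rfl⟩ : ∃ i, k = j + 1 + i := ⟨k - (j + 1), by omega⟩
      have h2 : (l m)⁻¹ ^ j * l m ^ j = 1 := by
        rw [← mul_pow, inv_mul_cancel₀ hl0.ne', one_pow]
      have h3 : (l m)⁻¹ ^ i ≤ 1 := pow_le_one₀ (inv_nonneg.2 hl0.le) (inv_le_one_of_one_le₀ (hl m))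
      calc (l m)⁻¹ ^ (j + 1 + i) * l m ^ j = ((l m)⁻¹ ^ j * l m ^ j) * ((l m)⁻¹ * (l m)⁻¹ ^ i) := by
            ring
        _ ≤ (l m)⁻¹ := by
            rw [h2, one_mul]
            exact mul_le_of_le_one_right (inv_nonneg.2 hl0.le) h3
    have h2 : ‖iteratedDeriv j (g k) (l m * x)‖ ≤ D m :=
      (hC j k _).trans (hCD j k m (by omega) (by omega))
    have h3 : |c m| * D m * (l m)⁻¹ ≤ (1 / 2) ^ m := by
      rw [← div_eq_mul_inv, div_le_iff₀ hl0, one_div, inv_pow, ← div_eq_inv_mul,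
        le_div_iff₀ (by positivity)]
      simp only [l]; nlinarith [mul_nonneg (abs_nonneg (c m)) (hD0 m)]
    have h4 : ((1 : ℝ) / 2) ^ m ≤ (1 / 2) ^ k :=
      pow_le_pow_of_le_one (by norm_num) (by norm_num) (by omega)
    calc |c m| * (l m)⁻¹ ^ k * (l m ^ j * ‖iteratedDeriv j (g k) (l m * x)‖)
        = |c m| * (((l m)⁻¹ ^ k * l m ^ j) * ‖iteratedDeriv j (g k) (l m * x)‖) := by ring
      _ ≤ |c m| * ((l m)⁻¹ * D m) := by
          refine mul_le_mul_of_nonneg_left (mul_le_mul h1 h2 (norm_nonneg _)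
            (inv_nonneg.2 hl0.le)) (abs_nonneg _)
      _ = |c m| * D m * (l m)⁻¹ := by ring
      _ ≤ _ := h3.trans h4
  have hsum : Summable fun k : ℕ => ((1 : ℝ) / 2) ^ k := summable_geometric_two
  let T : ℕ → ℝ → ℝ := fun n x => ∑' k, F n k x
  have hT : ∀ n, ContDiff ℝ ∞ (T n) := fun n => by
    refine contDiff_tsum_of_eventually (N := ⊤) (v := fun _ k => (1 / 2) ^ k) (hFs n)
      (fun _ _ => hsum) fun j _ => ?_
    rw [Nat.cofinite_eq_atTop]
    filter_upwards [Filter.eventually_gt_atTop j] with k hk x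
    rw [norm_iteratedFDeriv_eq_norm_iteratedDeriv]
    exact hFb n j k x hk
  have hTs : ∀ n x, Summable fun k => F n k x := fun n x => by
    refine Summable.of_norm_bounded_eventually_nat hsum ?_
    filter_upwards [Filter.eventually_gt_atTop 0] with k hk
    simpa using hFb n 0 k x hk
  have hrec : ∀ n x, T n x = c n * χ (l n * x) + x * T (n + 1) x := fun n x => by
    simp only [T]
    rw [(hTs n x).tsum_eq_zero_add, ← tsum_mul_left]
    congr 1
    · simp [F]
    · refine tsum_congr fun k => ?_
      have : k + 1 + n = k + (n + 1) := by omega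
      simp only [F, this]
      ring
  have hχd : ∀ m n, ∃ e : ℝ → ℝ, ContDiff ℝ ∞ e ∧ ∀ x, χ (l m * x) = 1 + x ^ n * e x := by
    intro m n
    have h1 : ContDiff ℝ ∞ fun x : ℝ => χ (l m * x) - 1 :=
      (hχ.comp (contDiff_const.mul contDiff_id)).sub contDiff_const
    have h2 : (fun x : ℝ => χ (l m * x) - 1) =ᶠ[𝓝 0] 0 := by
      have h3 : Filter.Tendsto (fun x : ℝ => l m * x) (𝓝 0) (𝓝 0) := by
        simpa using (continuous_const_mul (l m)).tendsto (0 : ℝ)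
      filter_upwards [h3.eventually χ.eventuallyEq_one] with x hx
      simp [hx]
    obtain ⟨e, he, h⟩ := exists_contDiff_eq_pow_mul h1 h2 n
    exact ⟨e, he, fun x => by rw [← h x]; ring⟩
  refine ⟨T 0, hT 0, fun n => ?_⟩
  have key : ∀ j ≤ n, ∃ R : ℝ → ℝ, ContDiff ℝ ∞ R ∧
      ∀ x, T 0 x = ∑ k ∈ Finset.range j, c k * x ^ k + x ^ j * T j x + x ^ n * R x := by
    intro j
    induction j with
    | zero => exact fun _ => ⟨0, contDiff_const, fun x => by simp⟩
    | succ j ih =>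
      intro hj
      obtain ⟨R, hR, h⟩ := ih (by omega)
      obtain ⟨e, he, h'⟩ := hχd j n
      refine ⟨fun x => R x + c j * x ^ j * e x,
        hR.add ((contDiff_const.mul (contDiff_id.pow j)).mul he), fun x => ?_⟩
      rw [h, hrec, h', Finset.sum_range_succ]
      ring
  obtain ⟨R, hR, h⟩ := key n le_rfl
  exact ⟨fun x => T n x + R x, (hT n).add hR, fun x => by rw [h]; ring⟩

/-! ### Even and odd smooth functions -/

/-- `f` is smooth and infinitely flat at `0`: it is a smooth multiple of every power of `x`. -/
def IsFlat (f : ℝ → ℝ) : Prop := ∀ n : ℕ, ∃ g : ℝ → ℝ, ContDiff ℝ ∞ g ∧ ∀ x, f x = x ^ n * g x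

theorem IsFlat.contDiff {f : ℝ → ℝ} (hf : IsFlat f) : ContDiff ℝ ∞ f := by
  obtain ⟨g, hg, h⟩ := hf 0
  have : f = g := funext fun x => by simp [h]
  rwa [this]

theorem eq_of_mul_eq_mul {f g : ℝ → ℝ} (hf : Continuous f) (hg : Continuous g)
    (h : ∀ x, x * f x = x * g x) : f = g :=
  hf.ext_on (dense_compl_singleton (0 : ℝ)) hg fun x hx => mul_left_cancel₀ hx (h x)

theorem IsFlat.exists_eq_mul {f : ℝ → ℝ} (hf : IsFlat f) :
    ∃ g, IsFlat g ∧ ∀ x, f x = x * g x := by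
  obtain ⟨g, hg, h⟩ := hf 1
  refine ⟨g, fun n => ?_, fun x => by simpa using h x⟩
  obtain ⟨k, hk, h'⟩ := hf (n + 1)
  have e : g = fun x => x ^ n * k x := by
    refine eq_of_mul_eq_mul hg.continuous ((continuous_pow n).mul hk.continuous) fun x => ?_
    have h1 := h x
    rw [h' x] at h1
    linear_combination -h1
  exact ⟨k, hk, fun x => congrFun e x⟩

theorem IsFlat.deriv {f : ℝ → ℝ} (hf : IsFlat f) : IsFlat (deriv f) := by
  intro n
  obtain ⟨g, hg, h⟩ := hf (n + 1)
  refine ⟨fun x => (n + 1) * g x + x * _root_.deriv g x,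
    (contDiff_const.mul hg).add (contDiff_id.mul (contDiff_infty_iff_deriv.1 hg).2), fun x => ?_⟩
  have e : f = fun x => x ^ (n + 1) * g x := funext h
  rw [e, ((hasDerivAt_pow (n + 1) x).fun_mul (hg.differentiable (by simp) x).hasDerivAt).deriv]
  push_cast
  ring

theorem IsFlat.add {f g : ℝ → ℝ} (hf : IsFlat f) (hg : IsFlat g) :
    IsFlat fun x => f x + g x := fun n => by
  obtain ⟨a, ha, h⟩ := hf n
  obtain ⟨b, hb, h'⟩ := hg n
  exact ⟨fun x => a x + b x, ha.add hb, fun x => by beta_reduce; rw [h, h']; ring⟩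

theorem IsFlat.const_mul {f : ℝ → ℝ} (hf : IsFlat f) (c : ℝ) : IsFlat fun x => c * f x := fun n => by
  obtain ⟨a, ha, h⟩ := hf n
  exact ⟨fun x => c * a x, contDiff_const.mul ha, fun x => by beta_reduce; rw [h]; ring⟩

theorem IsFlat.comp_neg {f : ℝ → ℝ} (hf : IsFlat f) : IsFlat fun x => f (-x) := fun n => by
  obtain ⟨a, ha, h⟩ := hf n
  exact ⟨fun x => (-1) ^ n * a (-x), contDiff_const.mul (ha.comp contDiff_neg),
    fun x => by beta_reduce; rw [h, neg_pow]; ring⟩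

/-- A flat function composed with the square root, extended by zero to the left, is smooth: the
derivative is of the same form, with `f` replaced by `f' / (2 x)`. -/
theorem IsFlat.contDiff_sqrt {f : ℝ → ℝ} (hf : IsFlat f) :
    ContDiff ℝ ∞ fun y => if 0 < y then f (√y) else 0 := by
  refine contDiff_of_forall_exists_hasDerivAt
    (fun F => ∃ f, IsFlat f ∧ F = fun y => if 0 < y then f (√y) else 0) ?_ _ ⟨f, hf, rfl⟩
  rintro F ⟨f, hf, rfl⟩
  obtain ⟨g, hg, h⟩ := hf.deriv.exists_eq_mul
  refine ⟨_, ⟨_, hg.const_mul (1 / 2), rfl⟩, fun x => ?_⟩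
  rcases lt_trichotomy x 0 with hx | rfl | hx
  · rw [if_neg hx.not_gt]
    refine (hasDerivAt_const x (0 : ℝ)).congr_of_eventuallyEq ?_
    filter_upwards [Iio_mem_nhds hx] with y hy
    rw [if_neg (not_lt.2 (le_of_lt hy))]
  · obtain ⟨k, hk, hfk⟩ := hf 4
    have hkc := hk.continuous
    rw [if_neg (lt_irrefl _), hasDerivAt_iff_tendsto_slope]
    have h1 : Filter.Tendsto (fun y : ℝ => max y 0 * k (√y)) (𝓝[≠] 0) (𝓝 0) := by
      have : Continuous fun y : ℝ => max y 0 * k (√y) := by fun_prop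
      simpa using (this.tendsto 0).mono_left nhdsWithin_le_nhds
    refine h1.congr' ?_
    filter_upwards [self_mem_nhdsWithin] with y hy
    rw [slope_def_field, if_neg (lt_irrefl _), sub_zero, sub_zero]
    split_ifs with hy0
    · rw [hfk, max_eq_left hy0.le, show √y ^ 4 = (√y ^ 2) ^ 2 by ring, Real.sq_sqrt hy0.le]
      field_simp
    · rw [max_eq_right (not_lt.1 hy0)]
      simp
  · rw [if_pos hx]
    have h1 : HasDerivAt f (√x * g (√x)) (√x) := by
      rw [← h]
      exact (hf.contDiff.differentiable (by simp) _).hasDerivAt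
    have h2 := h1.comp x (Real.hasDerivAt_sqrt hx.ne')
    refine (h2.congr_deriv ?_).congr_of_eventuallyEq ?_
    · have := (Real.sqrt_pos.2 hx).ne'
      field_simp
    · filter_upwards [Ioi_mem_nhds hx] with y hy
      exact if_pos hy

/-- A flat even function is a smooth function of `x ^ 2`. -/
theorem IsFlat.exists_eq_comp_sq {f : ℝ → ℝ} (hf : IsFlat f) (he : ∀ x, f (-x) = f x) :
    ∃ A : ℝ → ℝ, ContDiff ℝ ∞ A ∧ ∀ x, f x = A (x ^ 2) := by
  refine ⟨_, hf.contDiff_sqrt, fun x => ?_⟩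
  split_ifs with h
  · rw [Real.sqrt_sq_eq_abs]
    rcases abs_choice x with h | h <;> rw [h]
    exact (he x).symm
  · have : x = 0 := by
      by_contra h0
      exact h (by positivity)
    obtain ⟨g, -, hg⟩ := hf 1
    rw [hg, this]
    simp

/-- **Whitney's theorem** on even and odd functions: every smooth function is of the form
`A (x ^ 2) + x * C (x ^ 2)` with `A` and `C` smooth. Borel's lemma provides `A` and `C` up to a
flat error, whose even and odd parts are functions of `x ^ 2` through the square root. -/
theorem exists_eq_comp_sq_add_mul_comp_sq {f : ℝ → ℝ} (hf : ContDiff ℝ ∞ f) :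
    ∃ A C : ℝ → ℝ, ContDiff ℝ ∞ A ∧ ContDiff ℝ ∞ C ∧ ∀ x, f x = A (x ^ 2) + x * C (x ^ 2) := by
  obtain ⟨c, hc⟩ := exists_hasTaylorCoeffs hf
  obtain ⟨A, hA, hAc⟩ := exists_contDiff_hasTaylorCoeffs fun n => c (2 * n)
  obtain ⟨C, hC, hCc⟩ := exists_contDiff_hasTaylorCoeffs fun n => c (2 * n + 1)
  have hsq : ContDiff ℝ ∞ fun x : ℝ => x ^ 2 := contDiff_id.pow 2
  have hr : IsFlat fun x => f x - A (x ^ 2) - x * C (x ^ 2) := by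
    intro n
    obtain ⟨R, hR, h⟩ := hc (2 * n)
    obtain ⟨R₁, hR₁, h₁⟩ := hAc n
    obtain ⟨R₂, hR₂, h₂⟩ := hCc n
    have hs : ∀ x : ℝ, ∑ k ∈ Finset.range (2 * n), c k * x ^ k =
        ∑ k ∈ Finset.range n, c (2 * k) * (x ^ 2) ^ k +
          x * ∑ k ∈ Finset.range n, c (2 * k + 1) * (x ^ 2) ^ k := fun x => by
      clear h h₁ h₂
      induction n with
      | zero => simp
      | succ n ih =>
        rw [show 2 * (n + 1) = 2 * n + 1 + 1 by ring, Finset.sum_range_succ, Finset.sum_range_succ,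
          ih, Finset.sum_range_succ, Finset.sum_range_succ]
        ring
    refine ⟨fun x => x ^ n * (R x - R₁ (x ^ 2) - x * R₂ (x ^ 2)),
      (contDiff_id.pow n).mul ((hR.sub (hR₁.comp hsq)).sub (contDiff_id.mul (hR₂.comp hsq))),
      fun x => ?_⟩
    beta_reduce
    rw [h, h₁, h₂, hs]
    ring
  set r := fun x => f x - A (x ^ 2) - x * C (x ^ 2) with hrdef
  obtain ⟨A', hA', hA'r⟩ := ((hr.add hr.comp_neg).const_mul (1 / 2)).exists_eq_comp_sq
    fun x => by rw [neg_neg]; ring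
  obtain ⟨o, ho, hor⟩ := ((hr.add (hr.comp_neg.const_mul (-1))).const_mul (1 / 2)).exists_eq_mul
  have hoe : ∀ x, o (-x) = o x := by
    have hoc := ho.contDiff.continuous
    refine congrFun (eq_of_mul_eq_mul (hoc.comp continuous_neg) hoc fun x => ?_)
    have h1 := hor x
    have h2 := hor (-x)
    rw [neg_neg] at h2
    change x * o (-x) = x * o x
    linear_combination h1 + h2
  obtain ⟨C', hC', hC'o⟩ := ho.exists_eq_comp_sq hoe
  refine ⟨fun y => A y + A' y, fun y => C y + C' y, hA.add hA', hC.add hC', fun x => ?_⟩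
  have h1 := hA'r x
  have h2 := hor x
  rw [hC'o] at h2
  have h3 : f x = r x + A (x ^ 2) + x * C (x ^ 2) := by simp only [hrdef]; ring
  rw [h3]
  linear_combination h1 + h2

/-! ### Germs and the inverse function theorem on the line -/

/-- A function smooth near a point agrees near that point with a globally smooth function. -/
theorem exists_contDiff_eventuallyEq {E : Type*} [NormedAddCommGroup E] [NormedSpace ℝ E]
    {f : ℝ → E} {J : Set ℝ} {a : ℝ} (hJ : IsOpen J) (ha : a ∈ J) (hf : ContDiffOn ℝ ∞ f J) :
    ∃ g : ℝ → E, ContDiff ℝ ∞ g ∧ g =ᶠ[𝓝 a] f := by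
  obtain ⟨r, hr, hrJ⟩ := Metric.isOpen_iff.1 hJ a ha
  let χ : ContDiffBump a := ⟨r / 4, r / 2, by linarith, by linarith⟩
  refine ⟨fun s => χ s • f s, contDiff_iff_contDiffAt.2 fun s => ?_, ?_⟩
  · by_cases hs : s ∈ J
    · exact χ.contDiff.contDiffAt.smul (hf.contDiffAt (hJ.mem_nhds hs))
    · have h1 : s ∉ tsupport χ := fun h => by
        rw [χ.tsupport_eq] at h
        refine hs (hrJ (Metric.closedBall_subset_ball ?_ h))
        change r / 2 < r
        linarith
      refine (contDiffAt_const (c := (0 : E))).congr_of_eventuallyEq ?_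
      filter_upwards [notMem_tsupport_iff_eventuallyEq.1 h1] with y hy
      simp [hy]
  · filter_upwards [χ.eventuallyEq_one] with s hs
    simp [hs]

/-- The inverse function theorem for smooth functions of one variable. -/
theorem exists_openPartialHomeomorph_of_deriv_ne_zero {h : ℝ → ℝ} (hh : ContDiff ℝ ∞ h) {a : ℝ}
    (ha : deriv h a ≠ 0) :
    ∃ φ : OpenPartialHomeomorph ℝ ℝ, (φ : ℝ → ℝ) = h ∧ a ∈ φ.source ∧
      ContDiffOn ℝ ∞ φ.symm φ.target := by
  have hd : ∀ x, HasDerivAt h (deriv h x) x := fun x =>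
    (hh.differentiable (by simp) x).hasDerivAt
  have hO : IsOpen {x | deriv h x ≠ 0} :=
    isOpen_ne_fun (hh.continuous_deriv (by simp)) continuous_const
  let φ₀ := hh.contDiffAt.toOpenPartialHomeomorph h ((hd a).hasFDerivAt_equiv ha) (by simp)
  have h0 : (φ₀ : ℝ → ℝ) = h := rfl
  have ha0 : a ∈ φ₀.source :=
    hh.contDiffAt.mem_toOpenPartialHomeomorph_source ((hd a).hasFDerivAt_equiv ha) (by simp)
  refine ⟨φ₀.restrOpen _ hO, rfl, ⟨ha0, ha⟩, fun y hy => ?_⟩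
  have h1 := (φ₀.restrOpen _ hO).map_target hy
  exact ((φ₀.restrOpen _ hO).contDiffAt_symm_deriv h1.2 hy (hd _)
    hh.contDiffAt).contDiffWithinAt

theorem exists_contDiff_eq_add_sub_mul {f : ℝ → ℝ} (hf : ContDiff ℝ ∞ f) (a : ℝ) :
    ∃ g : ℝ → ℝ, ContDiff ℝ ∞ g ∧ ∀ x, f x = f a + (x - a) * g x := by
  obtain ⟨g, hg, h⟩ := exists_contDiff_eq_add_mul
    (hf.comp (contDiff_const.add contDiff_id : ContDiff ℝ ∞ fun x : ℝ => a + x))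
  refine ⟨fun x => g (x - a), hg.comp (contDiff_id.sub contDiff_const), fun x => ?_⟩
  simpa using h (x - a)

theorem iteratedDeriv_sub_pow_mul (n : ℕ) {g : ℝ → ℝ} (hg : ContDiff ℝ ∞ g) (a : ℝ) :
    iteratedDeriv n (fun x => (x - a) ^ n * g x) a = n.factorial * g a := by
  induction n generalizing g with
  | zero => simp
  | succ n ih =>
    have hg' := (contDiff_infty_iff_deriv.1 hg).2
    have e : deriv (fun x => (x - a) ^ (n + 1) * g x) =
        fun x => (x - a) ^ n * ((n + 1) * g x + (x - a) * deriv g x) := by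
      funext x
      have h1 : HasDerivAt (fun x => (x - a) ^ (n + 1)) (((n + 1 : ℕ) : ℝ) * (x - a) ^ n) x := by
        simpa using ((hasDerivAt_id x).sub_const a).fun_pow (n + 1)
      rw [(h1.fun_mul (hg.differentiable (by simp) x).hasDerivAt).deriv]
      push_cast
      ring
    have hs : ContDiff ℝ ∞ fun x => (n + 1) * g x + (x - a) * deriv g x :=
      (contDiff_const.mul hg).add ((contDiff_id.sub contDiff_const).mul hg')
    rw [iteratedDeriv_succ', e, ih hs, Nat.factorial_succ]
    push_cast
    ring

/-- Hadamard's lemma at a zero of order `n`. -/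
theorem exists_contDiff_eq_sub_pow_mul (n : ℕ) {f : ℝ → ℝ} (hf : ContDiff ℝ ∞ f) (a : ℝ)
    (h : ∀ j < n, iteratedDeriv j f a = 0) :
    ∃ g : ℝ → ℝ, ContDiff ℝ ∞ g ∧ (∀ x, f x = (x - a) ^ n * g x) ∧
      n.factorial * g a = iteratedDeriv n f a := by
  induction n with
  | zero => exact ⟨f, hf, fun x => by simp, by simp⟩
  | succ n ih =>
    obtain ⟨g, hg, hfg, hga⟩ := ih fun j hj => h j (by omega)
    rw [h n (by omega)] at hga
    have hga0 : g a = 0 := by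
      rcases mul_eq_zero.1 hga with h0 | h0
      · exact absurd h0 (by exact_mod_cast n.factorial_ne_zero)
      · exact h0
    obtain ⟨k, hk, hgk⟩ := exists_contDiff_eq_add_sub_mul hg a
    have e : f = fun x => (x - a) ^ (n + 1) * k x := funext fun x => by
      rw [hfg, hgk, hga0]
      ring
    exact ⟨k, hk, fun x => congrFun e x, by rw [e, iteratedDeriv_sub_pow_mul _ hk]⟩

/-! ### Normal forms of space curves -/

/-- The germ at `s₀` of the space curve `c` is carried to the germ of `β` at `0` by a local
diffeomorphism `φ` of the line and a diffeomorphism `Φ` (with inverse `Ψ`) of an open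
neighbourhood of the origin onto itself. -/
def IsGermEquivalent (c : ℝ → R3) (s₀ : ℝ) (β : ℝ → R3) : Prop :=
  ∃ (φ : OpenPartialHomeomorph ℝ ℝ) (P : Set R3) (Φ Ψ : R3 → R3),
    s₀ ∈ φ.source ∧ φ s₀ = 0 ∧ ContDiff ℝ ∞ φ ∧ ContDiffOn ℝ ∞ φ.symm φ.target ∧
    IsOpen P ∧ (0 : R3) ∈ P ∧ ContDiffOn ℝ ∞ Φ P ∧ ContDiffOn ℝ ∞ Ψ P ∧
    MapsTo Φ P P ∧ MapsTo Ψ P P ∧ LeftInvOn Ψ Φ P ∧ LeftInvOn Φ Ψ P ∧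
    ∀ᶠ s in 𝓝 s₀, Φ (c s) = β (φ s)

theorem contDiffOn_vec3 {E : Type*} [NormedAddCommGroup E] [NormedSpace ℝ E] {s : Set E}
    {a b c : E → ℝ} (ha : ContDiffOn ℝ ∞ a s) (hb : ContDiffOn ℝ ∞ b s)
    (hc : ContDiffOn ℝ ∞ c s) : ContDiffOn ℝ ∞ (fun y => (![a y, b y, c y] : R3)) s := by
  refine contDiffOn_pi.2 fun i => ?_
  fin_cases i
  · exact ha
  · exact hb
  · exact hc

theorem vec3_ext {x y : R3} (h0 : x 0 = y 0) (h1 : x 1 = y 1) (h2 : x 2 = y 2) : x = y := by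
  funext i
  fin_cases i
  · exact h0
  · exact h1
  · exact h2

/-- A regular curve is straightened by subtracting its expression as a graph. -/
theorem isGermEquivalent_lineCurve {c : ℝ → R3} (hc : ContDiff ℝ ∞ c) {s₀ : ℝ} (h0 : c s₀ = 0)
    (h1 : deriv (fun s => c s 0) s₀ ≠ 0) : IsGermEquivalent c s₀ lineCurve := by
  have hci : ∀ i, ContDiff ℝ ∞ fun s => c s i := fun i => contDiff_pi.1 hc i
  obtain ⟨φ, hφ, hs, hsymm⟩ := exists_openPartialHomeomorph_of_deriv_ne_zero (hci 0) h1
  have hφ0 : φ s₀ = 0 := by simp [hφ, h0]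
  have ht : (0 : ℝ) ∈ φ.target := by rw [← hφ0]; exact φ.map_source hs
  have hext : ∀ i, ∃ g : ℝ → ℝ, ContDiff ℝ ∞ g ∧ g =ᶠ[𝓝 0] fun x => c (φ.symm x) i := fun i =>
    exists_contDiff_eventuallyEq φ.open_target ht ((hci i).comp_contDiffOn hsymm)
  obtain ⟨f, hf, hfe⟩ := hext 1
  obtain ⟨g, hg, hge⟩ := hext 2
  have hp : ∀ i : Fin 3, ContDiff ℝ ∞ fun y : R3 => y i := fun i => contDiff_apply ℝ ℝ i
  refine ⟨φ, univ, fun y => ![y 0, y 1 - f (y 0), y 2 - g (y 0)],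
    fun y => ![y 0, y 1 + f (y 0), y 2 + g (y 0)], hs, hφ0, by rw [hφ]; exact hci 0, hsymm,
    isOpen_univ, mem_univ _, ?_, ?_, mapsTo_univ _ _, mapsTo_univ _ _, ?_, ?_, ?_⟩
  · exact contDiffOn_vec3 (hp 0).contDiffOn ((hp 1).sub (hf.comp (hp 0))).contDiffOn
      ((hp 2).sub (hg.comp (hp 0))).contDiffOn
  · exact contDiffOn_vec3 (hp 0).contDiffOn ((hp 1).add (hf.comp (hp 0))).contDiffOn
      ((hp 2).add (hg.comp (hp 0))).contDiffOn
  · intro y _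
    apply vec3_ext <;> simp
  · intro y _
    apply vec3_ext <;> simp
  · have hcont : Filter.Tendsto φ (𝓝 s₀) (𝓝 0) := by
      have := φ.continuousAt hs
      rwa [ContinuousAt, hφ0] at this
    filter_upwards [hcont.eventually hfe, hcont.eventually hge, φ.eventually_left_inverse hs]
      with s h1 h2 h3
    rw [h3] at h1 h2
    have h4 : φ s = c s 0 := by rw [hφ]
    rw [h4] at h1 h2 ⊢
    apply vec3_ext <;> simp [lineCurve, h1, h2]

/-- The normal form of the `(2,3,4)`-cusp. In the parameter `x = √(c 0)` the components are smooth
functions of `x` divisible by `x ^ 2`, `x ^ 3` and `x ^ 2`, hence of the form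
`x ^ 2`, `x ^ 3 * E + x ^ 4 * O` and `x ^ 2 * E' + x ^ 3 * O'` with `E`, `O`, `E'`, `O'` smooth in
`x ^ 2`. As `x ^ 4 - (x ^ 2) ^ 2` vanishes on the cusp, it may be added to the last component; the
curve is then the image of the cusp under a triangular diffeomorphism. -/
theorem isGermEquivalent_cusp234 {c : ℝ → R3} (hc : ContDiff ℝ ∞ c) {s₀ : ℝ} (h0 : c s₀ = 0)
    (h1 : ∀ i, deriv (fun s => c s i) s₀ = 0)
    (h02 : 0 < iteratedDeriv 2 (fun s => c s 0) s₀)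
    (h12 : iteratedDeriv 2 (fun s => c s 1) s₀ = 0)
    (h13 : iteratedDeriv 3 (fun s => c s 1) s₀ ≠ 0) : IsGermEquivalent c s₀ cusp234 := by
  have hci : ∀ i, ContDiff ℝ ∞ fun s => c s i := fun i => contDiff_pi.1 hc i
  have hlow : ∀ i, ∀ j < 2, iteratedDeriv j (fun s => c s i) s₀ = 0 := fun i j hj => by
    interval_cases j
    · simp [h0]
    · rw [iteratedDeriv_one]; exact h1 i
  obtain ⟨u, hu, hcu, hu0⟩ := exists_contDiff_eq_sub_pow_mul 2 (hci 0) s₀ (hlow 0)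
  obtain ⟨v, hv, hcv, hv0⟩ := exists_contDiff_eq_sub_pow_mul 3 (hci 1) s₀ fun j hj => by
    rcases (by omega : j < 2 ∨ j = 2) with hj | rfl
    · exact hlow 1 j hj
    · exact h12
  obtain ⟨r, hr, hcr, -⟩ := exists_contDiff_eq_sub_pow_mul 2 (hci 2) s₀ (hlow 2)
  have hu0' : 0 < u s₀ := by
    rw [← hu0] at h02
    simpa using h02
  have hv0' : v s₀ ≠ 0 := by
    rintro h
    rw [h, mul_zero] at hv0
    exact h13 hv0.symm
  -- The new parameter.
  have hJ : IsOpen {s | 0 < u s} := isOpen_lt continuous_const hu.continuous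
  obtain ⟨h, hh, hhe⟩ := exists_contDiff_eventuallyEq (f := fun s => (s - s₀) * √(u s)) hJ
    (show s₀ ∈ _ from hu0') ((contDiff_id.sub contDiff_const).contDiffOn.mul
      (hu.contDiffOn.sqrt fun s hs => (show 0 < u s from hs).ne'))
  have hh0 : h s₀ = 0 := by simpa using hhe.self_of_nhds
  have hhd : deriv h s₀ = √(u s₀) := by
    rw [hhe.deriv_eq]
    have h2 : HasDerivAt (fun s => √(u s)) (deriv (fun s => √(u s)) s₀) s₀ :=
      ((hu.differentiable (by simp) s₀).sqrt hu0'.ne').hasDerivAt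
    have h3 := ((hasDerivAt_id s₀).sub_const s₀).fun_mul h2
    simpa using h3.deriv
  have hhd0 : deriv h s₀ ≠ 0 := by rw [hhd]; exact (Real.sqrt_pos.2 hu0').ne'
  obtain ⟨φ, hφ, hs, hsymm⟩ := exists_openPartialHomeomorph_of_deriv_ne_zero hh hhd0
  have hφ0 : φ s₀ = 0 := by rw [hφ, hh0]
  have ht : (0 : ℝ) ∈ φ.target := by rw [← hφ0]; exact φ.map_source hs
  have hcont : Filter.Tendsto φ (𝓝 s₀) (𝓝 0) := by
    have := φ.continuousAt hs
    rwa [ContinuousAt, hφ0] at this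
  obtain ⟨ψ, hψ, hψe⟩ := exists_contDiff_eventuallyEq φ.open_target ht hsymm
  have hψh : ∀ᶠ s in 𝓝 s₀, ψ (h s) = s := by
    filter_upwards [hcont.eventually hψe, φ.eventually_left_inverse hs] with s h1 h2
    rw [h2] at h1
    rwa [hφ] at h1
  have hψ0 : ψ 0 = s₀ := by simpa [hh0] using hψh.self_of_nhds
  obtain ⟨k, hk, hψk⟩ := exists_contDiff_eq_add_mul hψ
  rw [hψ0] at hψk
  have hk0 : k 0 ≠ 0 := by
    intro hk0
    have h2 : HasDerivAt (fun s => s₀ + h s * k (h s)) 0 s₀ := by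
      have h3 := ((hh.differentiable (by simp) s₀).hasDerivAt.fun_mul
        ((hk.comp hh).differentiable (by simp) s₀).hasDerivAt).const_add s₀
      simpa [hh0, hk0] using h3
    have h4 : HasDerivAt (fun s => s₀ + h s * k (h s)) 1 s₀ := by
      refine (hasDerivAt_id s₀).congr_of_eventuallyEq ?_
      filter_upwards [hψh] with s hs
      rw [← hψk, hs]
      rfl
    exact zero_ne_one (h2.unique h4)
  obtain ⟨E, O, hE, hO, hEO⟩ := exists_eq_comp_sq_add_mul_comp_sq
    ((hk.pow 3).mul (hv.comp hψ))
  obtain ⟨E', O', hE', hO', hEO'⟩ := exists_eq_comp_sq_add_mul_comp_sq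
    ((hk.pow 2).mul (hr.comp hψ))
  have hE0 : E 0 ≠ 0 := by
    have h2 := hEO 0
    simp only [Function.comp, hψ0] at h2
    norm_num at h2
    rw [← h2]
    exact mul_ne_zero (pow_ne_zero 3 hk0) hv0'
  have hp : ∀ i : Fin 3, ContDiff ℝ ∞ fun y : R3 => y i := fun i => contDiff_apply ℝ ℝ i
  have hEp := hE.comp (hp 0)
  have hOp := hO.comp (hp 0)
  have hEp' := hE'.comp (hp 0)
  have hOp' := hO'.comp (hp 0)
  have hB : ContDiffOn ℝ ∞ (fun y : R3 => (y 1 - y 0 ^ 2 * O (y 0)) / E (y 0))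
      {y | E (y 0) ≠ 0} :=
    ((hp 1).sub (((hp 0).pow 2).mul hOp)).contDiffOn.div hEp.contDiffOn fun y hy => hy
  refine ⟨φ, {y | E (y 0) ≠ 0},
    fun y => ![y 0, (y 1 - y 0 ^ 2 * O (y 0)) / E (y 0),
      y 2 - y 0 * E' (y 0) - (y 1 - y 0 ^ 2 * O (y 0)) / E (y 0) * O' (y 0) + y 0 ^ 2],
    fun y => ![y 0, y 1 * E (y 0) + y 0 ^ 2 * O (y 0),
      y 0 * E' (y 0) + y 1 * O' (y 0) + (y 2 - y 0 ^ 2)], hs, hφ0, by rw [hφ]; exact hh, hsymm,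
    isOpen_ne_fun hEp.continuous continuous_const, hE0, ?_, ?_, fun y hy => hy, fun y hy => hy,
    ?_, ?_, ?_⟩
  · exact contDiffOn_vec3 (hp 0).contDiffOn hB
      ((((hp 2).sub ((hp 0).mul hEp')).contDiffOn.sub (hB.mul hOp'.contDiffOn)).add
        ((hp 0).pow 2).contDiffOn)
  · exact contDiffOn_vec3 (hp 0).contDiffOn
      (((hp 1).mul hEp).add (((hp 0).pow 2).mul hOp)).contDiffOn
      ((((hp 0).mul hEp').add ((hp 1).mul hOp')).add ((hp 2).sub ((hp 0).pow 2))).contDiffOn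
  · intro y hy
    have hy' : E (y 0) ≠ 0 := hy
    apply vec3_ext
    · simp
    · simp; field_simp; ring
    · simp
  · intro y hy
    have hy' : E (y 0) ≠ 0 := hy
    apply vec3_ext
    · simp
    · simp; field_simp
    · simp; field_simp; ring
  · filter_upwards [hhe, hψh, hu.continuous.continuousAt.eventually (lt_mem_nhds hu0'),
      (hcont.eventually ((hE.continuous.comp (continuous_pow 2)).continuousAt.eventually
        (isOpen_ne.mem_nhds (by simpa using hE0 : E (0 ^ 2) ≠ 0))))] with s h1 h2 h3 h4
    rw [hφ] at h4 ⊢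
    set x := h s with hx
    have hE4 : E (x ^ 2) ≠ 0 := h4
    have hsx : s - s₀ = x * k x := by
      have := hψk x
      rw [h2] at this
      linear_combination this
    have e0 : c s 0 = x ^ 2 := by rw [hcu, h1, mul_pow, Real.sq_sqrt h3.le]
    have e1 : c s 1 = x ^ 3 * (E (x ^ 2) + x * O (x ^ 2)) := by
      rw [hcv, hsx, ← hEO]
      simp only [Function.comp, h2]
      ring
    have e2 : c s 2 = x ^ 2 * (E' (x ^ 2) + x * O' (x ^ 2)) := by
      rw [hcr, hsx, ← hEO']
      simp only [Function.comp, h2]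
      ring
    apply vec3_ext
    · simp [cusp234, e0]
    · simp [cusp234, e0, e1]; field_simp; ring
    · simp [cusp234, e0, e1, e2]; field_simp; ring

/-! ### The pseudo-scalar product -/

theorem mink_comm (x y : R4) : mink x y = mink y x := by simp only [mink]; ring

theorem mink_add_left (x y z : R4) : mink (x + y) z = mink x z + mink y z := by
  simp only [mink, Pi.add_apply]; ring

theorem mink_add_right (x y z : R4) : mink x (y + z) = mink x y + mink x z := by
  simp only [mink, Pi.add_apply]; ring

theorem mink_sub_left (x y z : R4) : mink (x - y) z = mink x z - mink y z := by
  simp only [mink, Pi.sub_apply]; ring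

theorem mink_smul_left (a : ℝ) (x y : R4) : mink (a • x) y = a * mink x y := by
  simp only [mink, Pi.smul_apply, smul_eq_mul]; ring

theorem mink_smul_right (a : ℝ) (x y : R4) : mink x (a • y) = a * mink x y := by
  simp only [mink, Pi.smul_apply, smul_eq_mul]; ring

theorem mink_neg_left (x y : R4) : mink (-x) y = -mink x y := by
  simp only [mink, Pi.neg_apply]; ring

theorem mink_zero_left (x : R4) : mink 0 x = 0 := by simp [mink]

/-- The linear form `⟨·, v⟩`. -/
def minkForm (v : R4) : R4 →ₗ[ℝ] ℝ where
  toFun x := mink x v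
  map_add' x y := mink_add_left x y v
  map_smul' a x := mink_smul_left a x v

theorem contDiff_mink {n : ℕ∞ω} : ContDiff ℝ n fun p : R4 × R4 => mink p.1 p.2 := by
  have h1 : ∀ i : Fin 4, ContDiff ℝ n fun p : R4 × R4 => p.1 i := fun i =>
    (contDiff_apply ℝ ℝ i).comp contDiff_fst
  have h2 : ∀ i : Fin 4, ContDiff ℝ n fun p : R4 × R4 => p.2 i := fun i =>
    (contDiff_apply ℝ ℝ i).comp contDiff_snd
  exact ((((h1 0).mul (h2 0)).neg.add ((h1 1).mul (h2 1))).add ((h1 2).mul (h2 2))).add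
    ((h1 3).mul (h2 3))

section Smoothness

variable {E : Type*} [NormedAddCommGroup E] [NormedSpace ℝ E]

theorem _root_.ContDiffOn.mink {s : Set E} {f g : E → R4} {n : ℕ∞ω} (hf : ContDiffOn ℝ n f s)
    (hg : ContDiffOn ℝ n g s) : ContDiffOn ℝ n (fun x => mink (f x) (g x)) s :=
  contDiff_mink.comp_contDiffOn (hf.prodMk hg)

theorem _root_.ContDiff.mink {f g : E → R4} {n : ℕ∞ω} (hf : ContDiff ℝ n f)
    (hg : ContDiff ℝ n g) : ContDiff ℝ n fun x => mink (f x) (g x) :=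
  contDiff_mink.comp (hf.prodMk hg)

end Smoothness

theorem _root_.HasDerivAt.mink {f g : ℝ → R4} {f' g' : R4} {s : ℝ} (hf : HasDerivAt f f' s)
    (hg : HasDerivAt g g' s) :
    HasDerivAt (fun s => mink (f s) (g s)) (mink f' (g s) + mink (f s) g') s := by
  have h1 := hasDerivAt_pi.1 hf
  have h2 := hasDerivAt_pi.1 hg
  have := ((((h1 0).fun_mul (h2 0)).fun_neg.fun_add ((h1 1).fun_mul (h2 1))).fun_add
    ((h1 2).fun_mul (h2 2))).fun_add ((h1 3).fun_mul (h2 3))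
  refine this.congr_deriv ?_
  simp only [Mink.mink]
  ring

/-! ### Charts of the de Sitter space -/

/-- Projecting the de Sitter space along one of its points `a` gives a chart near `a`. Together
with a normal form of the projected curve, and if the model curve does not return to the origin,
it provides the local diffeomorphism type. -/
theorem isLocallyDiffeoToCurve_of_isGermEquivalent {I : Set ℝ} (hI : IsOpen I) {s₀ : ℝ}
    (hs₀ : s₀ ∈ I) {α : ℝ → R4} (hα : ∀ s ∈ I, α s ∈ deSitter) (hαc : ContinuousOn α I)
    (p : Fin 3 → R4) (hp : ∀ i, mink (α s₀) (p i) = 0)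
    (hnd : ∀ x, (∀ i, mink x (p i) = 0) → mink x (α s₀) = 0 → x = 0)
    {c : ℝ → R3} (hc : ∀ᶠ s in 𝓝 s₀, c s = fun i => mink (α s) (p i))
    {β : ℝ → R3} (hβc : Continuous β) (hβ0 : β 0 = 0)
    (hβ : ∀ ε > 0, ∃ W : Set R3, IsOpen W ∧ ∀ x, β x ∈ W ↔ |x| < ε)
    (h : IsGermEquivalent c s₀ β) : IsLocallyDiffeoToCurve deSitter I α s₀ β := by
  obtain ⟨φ, P, Φ, Ψ, hs, hφ0, hφs, hφsymm, hPo, hP0, hΦ, hΨ, hΦP, hΨP, hl, hr, hev⟩ := h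
  set a := α s₀ with ha
  have haa : mink a a = 1 := hα s₀ hs₀
  let F : R4 →ₗ[ℝ] R3 := LinearMap.pi fun i => minkForm (p i)
  have hFi : ∀ x, F x = fun i => mink x (p i) := fun x => rfl
  have hFa : F a = 0 := funext hp
  let T : R4 →ₗ[ℝ] R3 × ℝ := F.prod (minkForm a)
  have hTinj : Function.Injective T := by
    rw [← LinearMap.ker_eq_bot, LinearMap.ker_eq_bot']
    intro x hx
    exact hnd x (fun i => congrFun (congrArg Prod.fst hx) i) (congrArg Prod.snd hx)
  let Te : R4 ≃ₗ[ℝ] R3 × ℝ := LinearEquiv.ofInjectiveOfFinrankEq T hTinj (by simp)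
  have hTe : ∀ x, Te x = (F x, mink x a) := fun x => rfl
  let L : R3 →ₗ[ℝ] R4 := Te.symm.toLinearMap ∘ₗ LinearMap.inl ℝ R3 ℝ
  have hTL : ∀ y, (F (L y), mink (L y) a) = (y, 0) := fun y => by
    rw [← hTe]
    exact Te.apply_symm_apply _
  have hFL : ∀ y, F (L y) = y := fun y => congrArg Prod.fst (hTL y)
  have hLa : ∀ y, mink (L y) a = 0 := fun y => congrArg Prod.snd (hTL y)
  have hLs : ContDiff ℝ ∞ L := L.toContinuousLinearMap.contDiff
  have hFs : ContDiff ℝ ∞ F := F.toContinuousLinearMap.contDiff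
  have hma : ContDiff ℝ ∞ fun x => mink x a := contDiff_id.mink contDiff_const
  let q : R3 → ℝ := fun y => mink (L y) (L y)
  have hq : ContDiff ℝ ∞ q := hLs.mink hLs
  have hdec : ∀ x, x = L (F x) + mink x a • a := fun x => by
    apply Te.injective
    rw [map_add, map_smul, hTe, hTe, hTe, hFL, hLa, hFa, haa]
    simp
  have hqF : ∀ x, q (F x) = mink x x - mink x a ^ 2 := fun x => by
    have h1 : mink x x = mink (L (F x) + mink x a • a) (L (F x) + mink x a • a) := by
      rw [← hdec x]
    rw [mink_add_left, mink_add_right, mink_add_right, mink_smul_left, mink_smul_left,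
      mink_smul_right, mink_smul_right, hLa, haa, mink_comm a, hLa] at h1
    linear_combination -h1
  -- the projection of the piece of the de Sitter space, and its target
  let f : R4 → R3 := fun x => Φ (F x)
  let g : R3 → R4 := fun y => L (Ψ y) + √(1 - q (Ψ y)) • a
  let V₀ : Set R4 := {x | F x ∈ P} ∩ {x | 0 < mink x a}
  let W₀ : Set R3 := P ∩ Ψ ⁻¹' {y | q y < 1}
  have hV₀ : IsOpen V₀ := (hPo.preimage hFs.continuous).inter
    (isOpen_lt continuous_const hma.continuous)
  have hW₀ : IsOpen W₀ := hΨ.continuousOn.isOpen_inter_preimage hPo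
    (isOpen_lt hq.continuous continuous_const)
  have hf : ContDiffOn ℝ ∞ f V₀ := hΦ.comp hFs.contDiffOn fun x hx => hx.1
  have hg : ContDiffOn ℝ ∞ g W₀ := by
    have hΨW : ContDiffOn ℝ ∞ Ψ W₀ := hΨ.mono inter_subset_left
    have h1 : ContDiffOn ℝ ∞ (fun y => √(1 - q (Ψ y))) W₀ :=
      (contDiffOn_const.sub (hq.comp_contDiffOn hΨW)).sqrt fun y hy => (sub_pos.2 hy.2).ne'
    have h2 : ContDiffOn ℝ ∞ (fun y => √(1 - q (Ψ y)) • a) W₀ := h1.smul contDiffOn_const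
    exact (hLs.comp_contDiffOn hΨW).add h2
  have hFg : ∀ y, F (g y) = Ψ y := fun y => by
    simp only [g]
    rw [map_add, map_smul, hFL, hFa, smul_zero, add_zero]
  have hga : ∀ y, mink (g y) a = √(1 - q (Ψ y)) := fun y => by
    simp only [g]
    rw [mink_add_left, mink_smul_left, hLa, haa, zero_add, mul_one]
  have hgV : ∀ y ∈ W₀, g y ∈ deSitter ∧ g y ∈ V₀ ∧ f (g y) = y := fun y hy => by
    have h1 : 0 < 1 - q (Ψ y) := sub_pos.2 hy.2
    refine ⟨?_, ⟨?_, ?_⟩, ?_⟩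
    · have h2 := hqF (g y)
      rw [hFg, hga, Real.sq_sqrt h1.le] at h2
      change mink (g y) (g y) = 1
      linarith
    · change F (g y) ∈ P
      rw [hFg]
      exact hΨP hy.1
    · change 0 < mink (g y) a
      rw [hga]
      exact Real.sqrt_pos.2 h1
    · change Φ (F (g y)) = y
      rw [hFg]
      exact hr hy.1
  have hgf : ∀ x ∈ deSitter, x ∈ V₀ → g (f x) = x := fun x hx hxV => by
    have h1 : Ψ (f x) = F x := hl hxV.1
    have h2 : q (F x) = 1 - mink x a ^ 2 := by
      rw [hqF, show mink x x = 1 from hx]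
    change L (Ψ (f x)) + √(1 - q (Ψ (f x))) • a = x
    rw [h1, h2, sub_sub_cancel, Real.sqrt_sq (le_of_lt hxV.2)]
    exact (hdec x).symm
  -- a symmetric parameter interval on which everything is defined
  have hαV : ∀ᶠ s in 𝓝 s₀, s ∈ I ∧ α s ∈ V₀ ∧ f (α s) = β (φ s) ∧ β (φ s) ∈ W₀ := by
    have hαa : ContinuousAt α s₀ := hαc.continuousAt (hI.mem_nhds hs₀)
    have haV : a ∈ V₀ := by
      refine ⟨?_, ?_⟩
      · change F a ∈ P
        rw [hFa]; exact hP0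
      · change 0 < mink a a
        rw [haa]; exact one_pos
    have hΦ0 : Φ 0 = 0 := by
      have h1 := hev.self_of_nhds
      rw [hc.self_of_nhds, ← hFi, hφ0, hβ0, ← ha, hFa] at h1
      exact h1
    have h0W : β (φ s₀) ∈ W₀ := by
      rw [hφ0, hβ0]
      refine ⟨hP0, ?_⟩
      have h1 : Ψ 0 = 0 := by
        have := hl hP0
        rwa [hΦ0] at this
      change q (Ψ 0) < 1
      rw [h1]
      simp only [q, map_zero, mink_zero_left]
      exact one_pos
    have hβφ : ContinuousAt (fun s => β (φ s)) s₀ :=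
      (hβc.comp hφs.continuous).continuousAt
    filter_upwards [hI.mem_nhds hs₀, hαa.eventually (hV₀.mem_nhds haV), hc, hev,
      hβφ.eventually (hW₀.mem_nhds h0W)] with s h1 h2 h3 h4 h5
    refine ⟨h1, h2, ?_, h5⟩
    rw [← h4, h3, ← hFi]
  have ht : (0 : ℝ) ∈ φ.target := by rw [← hφ0]; exact φ.map_source hs
  have hx : ∀ᶠ x in 𝓝 (0 : ℝ), x ∈ φ.target ∧ φ.symm x ∈ I ∧ α (φ.symm x) ∈ V₀ ∧
      f (α (φ.symm x)) = β (φ (φ.symm x)) ∧ β (φ (φ.symm x)) ∈ W₀ := by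
    have h1 : Filter.Tendsto φ.symm (𝓝 0) (𝓝 s₀) := by
      have h2 := φ.symm.continuousAt (x := 0) ht
      rwa [ContinuousAt, ← hφ0, φ.left_inv hs, hφ0] at h2
    exact Filter.Eventually.and (φ.open_target.mem_nhds ht) (h1.eventually hαV)
  obtain ⟨ε, hε, hball⟩ := Metric.eventually_nhds_iff.1 hx
  simp only [Real.dist_eq, sub_zero] at hball
  obtain ⟨W', hW', hβW'⟩ := hβ ε hε
  let φ' := φ.restrOpen (φ.source ∩ φ ⁻¹' {x | |x| < ε})
    (φ.isOpen_inter_preimage (isOpen_lt continuous_abs continuous_const))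
  have hsrc : ∀ s, s ∈ φ'.source ↔ s ∈ φ.source ∧ |φ s| < ε := fun s =>
    ⟨fun h => h.2, fun h => ⟨h.1, h⟩⟩
  have hG : ∀ s ∈ φ'.source, s ∈ I ∧ α s ∈ V₀ ∧ f (α s) = β (φ s) ∧ β (φ s) ∈ W₀ ∩ W' :=
      fun s hs' => by
    obtain ⟨h1, h2⟩ := (hsrc s).1 hs'
    obtain ⟨-, h3, h4, h5, h6⟩ := hball h2
    rw [φ.left_inv h1] at h3 h4 h5 h6
    exact ⟨h3, h4, h5, h6, (hβW' _).2 h2⟩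
  refine ⟨φ', V₀ ∩ f ⁻¹' (W₀ ∩ W'), W₀ ∩ W', f, g, (hsrc s₀).2 ⟨hs, by rwa [hφ0, abs_zero]⟩,
    fun s hs' => (hG s hs').1, hφ0, hφs.contDiffOn, hφsymm.mono fun x hx => hx.1,
    hf.continuousOn.isOpen_inter_preimage hV₀ (hW₀.inter hW'), hW₀.inter hW',
    hf.mono inter_subset_left, hg.mono inter_subset_left, fun x hx => hx.2.2, fun y hy => ?_,
    fun x hx => hgf x hx.1 hx.2.1, fun y hy => (hgV y hy.1).2.2, fun s hs' => ?_,
    fun s hs' => (hG s hs').2.2.1, ?_⟩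
  · obtain ⟨h1, h2, h3⟩ := hgV y hy.1
    refine ⟨h1, h2, ?_⟩
    rwa [mem_preimage, h3]
  · obtain ⟨h1, h2, h3, h4⟩ := hG s hs'
    refine ⟨hα s h1, h2, ?_⟩
    rwa [mem_preimage, h3]
  · ext y
    constructor
    · rintro ⟨_, ⟨s, hs', rfl⟩, rfl⟩
      obtain ⟨-, -, h3, h4⟩ := hG s hs'
      rw [h3]
      exact ⟨mem_range_self _, h4⟩
    · rintro ⟨⟨x, rfl⟩, hxW⟩
      have hxε : |x| < ε := (hβW' x).1 hxW.2
      obtain ⟨h1, -⟩ := hball hxε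
      have h2 : φ.symm x ∈ φ'.source := (hsrc _).2 ⟨φ.map_target h1, by rwa [φ.right_inv h1]⟩
      exact ⟨_, ⟨_, h2, rfl⟩, by rw [(hG _ h2).2.2.1, φ.right_inv h1]⟩

/-- The line passes through a small neighbourhood of the origin only for small parameters. -/
theorem lineCurve_mem_iff (ε : ℝ) :
    ∃ W : Set R3, IsOpen W ∧ ∀ x, lineCurve x ∈ W ↔ |x| < ε :=
  ⟨{y | |y 0| < ε}, isOpen_lt (continuous_abs.comp (continuous_apply 0)) continuous_const,
    fun x => by simp [lineCurve]⟩

theorem cusp234_mem_iff {ε : ℝ} (hε : 0 < ε) :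
    ∃ W : Set R3, IsOpen W ∧ ∀ x, cusp234 x ∈ W ↔ |x| < ε :=
  ⟨{y | y 0 < ε ^ 2}, isOpen_lt (continuous_apply 0) continuous_const, fun x => by
    simp [cusp234, sq_lt_sq, abs_of_pos hε]⟩

theorem continuous_lineCurve : Continuous lineCurve := by
  unfold lineCurve
  fun_prop

theorem continuous_cusp234 : Continuous cusp234 := by
  unfold cusp234
  fun_prop

/-! ### Linear algebra of Minkowski space -/

theorem wedge_apply (x y z : R4) : wedge x y z = ![
    -(x 1 * (y 2 * z 3 - y 3 * z 2) - x 2 * (y 1 * z 3 - y 3 * z 1) + x 3 * (y 1 * z 2 - y 2 * z 1)),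
    -(x 0 * (y 2 * z 3 - y 3 * z 2) - x 2 * (y 0 * z 3 - y 3 * z 0) + x 3 * (y 0 * z 2 - y 2 * z 0)),
    x 0 * (y 1 * z 3 - y 3 * z 1) - x 1 * (y 0 * z 3 - y 3 * z 0) + x 3 * (y 0 * z 1 - y 1 * z 0),
    -(x 0 * (y 1 * z 2 - y 2 * z 1) - x 1 * (y 0 * z 2 - y 2 * z 0) + x 2 * (y 0 * z 1 - y 1 * z 0))]
    := by
  funext i
  fin_cases i <;>
    simp [wedge, Matrix.det_succ_row_zero, Fin.sum_univ_succ, Fin.succAbove] <;> ring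

theorem mink_wedge_left (x y z : R4) : mink (wedge x y z) x = 0 := by
  rw [wedge_apply]; simp [mink]; ring

theorem mink_wedge_middle (x y z : R4) : mink (wedge x y z) y = 0 := by
  rw [wedge_apply]; simp [mink]; ring

theorem mink_wedge_right (x y z : R4) : mink (wedge x y z) z = 0 := by
  rw [wedge_apply]; simp [mink]; ring

/-- The square of the pseudo vector product is minus the Gram determinant. -/
theorem mink_wedge_self (x y z : R4) : mink (wedge x y z) (wedge x y z) =
    -(mink x x * (mink y y * mink z z - mink y z ^ 2)
      - mink x y * (mink x y * mink z z - mink y z * mink x z)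
      + mink x z * (mink x y * mink y z - mink y y * mink x z)) := by
  rw [wedge_apply]; simp [mink]; ring

theorem _root_.ContDiffOn.wedge {E : Type*} [NormedAddCommGroup E] [NormedSpace ℝ E] {s : Set E}
    {f g h : E → R4} {n : ℕ∞ω} (hf : ContDiffOn ℝ n f s) (hg : ContDiffOn ℝ n g s)
    (hh : ContDiffOn ℝ n h s) : ContDiffOn ℝ n (fun x => wedge (f x) (g x) (h x)) s := by
  have h1 := contDiffOn_pi.1 hf
  have h2 := contDiffOn_pi.1 hg
  have h3 := contDiffOn_pi.1 hh
  have hd : ∀ i j k, ContDiffOn ℝ n (fun x => f x i * (g x j * h x k - g x k * h x j)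
      - f x j * (g x i * h x k - g x k * h x i) + f x k * (g x i * h x j - g x j * h x i)) s :=
    fun i j k => (((h1 i).mul (((h2 j).mul (h3 k)).sub ((h2 k).mul (h3 j)))).sub
      ((h1 j).mul (((h2 i).mul (h3 k)).sub ((h2 k).mul (h3 i))))).add
      ((h1 k).mul (((h2 i).mul (h3 j)).sub ((h2 j).mul (h3 i))))
  simp only [wedge_apply]
  refine contDiffOn_pi.2 fun i => ?_
  fin_cases i
  · exact (hd 1 2 3).neg
  · exact (hd 0 2 3).neg
  · exact hd 0 1 3
  · exact (hd 0 1 2).neg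

/-- The orthogonal complement of a timelike unit vector contains no timelike vector. -/
theorem mink_self_nonneg_of_orthogonal {n x : R4} (hn : mink n n = -1) (h : mink x n = 0) :
    0 ≤ mink x x := by
  simp only [mink] at *
  have h1 : n 0 ^ 2 = 1 + (n 1 ^ 2 + n 2 ^ 2 + n 3 ^ 2) := by linarith
  have h2 : x 0 * n 0 = x 1 * n 1 + x 2 * n 2 + x 3 * n 3 := by linarith
  -- Cauchy-Schwarz for the spatial parts
  have h3 : (x 0 * n 0) ^ 2 ≤
      (x 1 ^ 2 + x 2 ^ 2 + x 3 ^ 2) * (n 1 ^ 2 + n 2 ^ 2 + n 3 ^ 2) := by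
    rw [h2]
    nlinarith [sq_nonneg (x 1 * n 2 - x 2 * n 1), sq_nonneg (x 1 * n 3 - x 3 * n 1),
      sq_nonneg (x 2 * n 3 - x 3 * n 2)]
  have h4 : 0 < n 0 ^ 2 := by rw [h1]; positivity
  have h5 : 0 ≤ (x 1 ^ 2 + x 2 ^ 2 + x 3 ^ 2 - x 0 ^ 2) * n 0 ^ 2 := by
    rw [mul_pow] at h3
    nlinarith [sq_nonneg (x 1), sq_nonneg (x 2), sq_nonneg (x 3)]
  have := nonneg_of_mul_nonneg_left h5 h4
  linarith

/-- Expansion in a pseudo-orthonormal frame. -/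
theorem eq_frame_expansion {n t a b : R4} (hnn : mink n n = -1) (htt : mink t t = 1)
    (haa : mink a a = 1) (hbb : mink b b = 1) (hnt : mink n t = 0) (hna : mink n a = 0)
    (hnb : mink n b = 0) (hta : mink t a = 0) (htb : mink t b = 0) (hab : mink a b = 0) (x : R4) :
    x = -mink x n • n + mink x t • t + mink x a • a + mink x b • b := by
  let S : R4 →ₗ[ℝ] R4 :=
    { toFun := fun y => y 0 • n + y 1 • t + y 2 • a + y 3 • b
      map_add' := fun y z => by simp only [Pi.add_apply, add_smul]; abel
      map_smul' := fun r y => by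
        simp only [Pi.smul_apply, smul_eq_mul, mul_smul, smul_add, RingHom.id_apply] }
  have hS : ∀ y, S y = y 0 • n + y 1 • t + y 2 • a + y 3 • b := fun y => rfl
  have e0 : ∀ y, mink (S y) n = -y 0 := fun y => by
    simp only [hS, mink_add_left, mink_smul_left, mink_comm t n, mink_comm a n, mink_comm b n, hnn,
      hnt, hna, hnb]
    ring
  have e1 : ∀ y, mink (S y) t = y 1 := fun y => by
    simp only [hS, mink_add_left, mink_smul_left, mink_comm a t, mink_comm b t, htt, hnt, hta, htb]
    ring
  have e2 : ∀ y, mink (S y) a = y 2 := fun y => by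
    simp only [hS, mink_add_left, mink_smul_left, mink_comm b a, haa, hna, hta, hab]
    ring
  have e3 : ∀ y, mink (S y) b = y 3 := fun y => by
    simp only [hS, mink_add_left, mink_smul_left, hbb, hnb, htb, hab]
    ring
  have hinj : Function.Injective S := by
    rw [← LinearMap.ker_eq_bot, LinearMap.ker_eq_bot']
    intro y hy
    funext i
    fin_cases i
    · have := e0 y
      rw [hy, mink_zero_left] at this
      simpa using this.symm
    · have := e1 y
      rw [hy, mink_zero_left] at this
      exact this.symm
    · have := e2 y
      rw [hy, mink_zero_left] at this
      exact this.symm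
    · have := e3 y
      rw [hy, mink_zero_left] at this
      exact this.symm
  obtain ⟨y, rfl⟩ := LinearMap.injective_iff_surjective.1 hinj x
  rw [e0, e1, e2, e3, neg_neg, hS]

theorem mink_deriv_left_eq_neg {f g : ℝ → R4} {C s : ℝ} (hf : DifferentiableAt ℝ f s)
    (hg : DifferentiableAt ℝ g s) (h : ∀ᶠ r in 𝓝 s, mink (f r) (g r) = C) :
    mink (deriv f s) (g s) = -mink (f s) (deriv g s) := by
  have h1 := hf.hasDerivAt.mink hg.hasDerivAt
  have h2 : HasDerivAt (fun r => mink (f r) (g r)) 0 s :=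
    (hasDerivAt_const s C).congr_of_eventuallyEq h
  linarith [h1.unique h2]

/-! ### Spacelike hypersurfaces -/

/-- Three vectors spanning a spacelike subspace have a timelike pseudo vector product, as their
Gram determinant is positive. -/
theorem mink_wedge_self_neg {a b d : R4}
    (h : ∀ x y z : ℝ, (x ≠ 0 ∨ y ≠ 0 ∨ z ≠ 0) →
      0 < mink (x • a + y • b + z • d) (x • a + y • b + z • d)) :
    mink (wedge a b d) (wedge a b d) < 0 := by
  have hexp : ∀ x y z : ℝ, mink (x • a + y • b + z • d) (x • a + y • b + z • d) =
      x ^ 2 * mink a a + y ^ 2 * mink b b + z ^ 2 * mink d d +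
        2 * (x * y * mink a b + x * z * mink a d + y * z * mink b d) := fun x y z => by
    simp only [mink_add_left, mink_add_right, mink_smul_left, mink_smul_right, mink_comm b a,
      mink_comm d a, mink_comm d b]
    ring
  simp only [hexp] at h
  rw [mink_wedge_self]
  generalize mink a a = A at *
  generalize mink b b = B at *
  generalize mink d d = D at *
  generalize mink a b = P at *
  generalize mink a d = Q at *
  generalize mink b d = R at *
  have hA : 0 < A := by simpa using h 1 0 0 (by simp)
  have h2 : 0 < A * B - P ^ 2 := by
    have := h (-P) A 0 (Or.inr (Or.inl hA.ne'))
    have e : 0 < A * (A * B - P ^ 2) := by linear_combination this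
    exact pos_of_mul_pos_right e hA.le
  -- the last column of the adjugate of the Gram matrix
  have := h (P * R - Q * B) (P * Q - A * R) (A * B - P ^ 2) (Or.inr (Or.inr h2.ne'))
  have e : 0 < (A * B - P ^ 2) *
      (A * (B * D - R ^ 2) - P * (P * D - R * Q) + Q * (P * R - B * Q)) := by
    linear_combination this
  linarith [pos_of_mul_pos_right e h2.le]

theorem fderiv_eq_partialX (X : R3 → R4) (u w : R3) :
    fderiv ℝ X u w = w 0 • partialX X 0 u + w 1 • partialX X 1 u + w 2 • partialX X 2 u := by
  have e : w = w 0 • Pi.single 0 1 + w 1 • Pi.single 1 1 + w 2 • Pi.single 2 1 := by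
    apply vec3_ext <;> simp
  conv_lhs => rw [e]
  simp only [map_add, map_smul, partialX]

section Hypersurface

variable {U : Set R3} {X : R3 → R4}

theorem IsSpacelikeEmbedding.wedge_partialX_neg (hX : IsSpacelikeEmbedding U X) {u : R3}
    (hu : u ∈ U) : mink (wedge (partialX X 0 u) (partialX X 1 u) (partialX X 2 u))
      (wedge (partialX X 0 u) (partialX X 1 u) (partialX X 2 u)) < 0 := by
  refine mink_wedge_self_neg fun x y z h => ?_
  have h1 := hX.spacelike u hu ![x, y, z] fun h0 => by
    have e0 : x = 0 := congrFun h0 0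
    have e1 : y = 0 := congrFun h0 1
    have e2 : z = 0 := congrFun h0 2
    simp [e0, e1, e2] at h
  rw [fderiv_eq_partialX] at h1
  exact h1

theorem IsSpacelikeEmbedding.mink_unitNormal (hX : IsSpacelikeEmbedding U X) {u : R3}
    (hu : u ∈ U) : mink (unitNormal X u) (unitNormal X u) = -1 := by
  have h := hX.wedge_partialX_neg hu
  rw [unitNormal, mink_smul_left, mink_smul_right, mnorm, abs_of_neg h]
  set m := mink (wedge (partialX X 0 u) (partialX X 1 u) (partialX X 2 u))
      (wedge (partialX X 0 u) (partialX X 1 u) (partialX X 2 u))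
  have h1 : 0 < -m := neg_pos.2 h
  have h2 := Real.sq_sqrt h1.le
  have h3 := (Real.sqrt_pos.2 h1).ne'
  field_simp
  linarith

theorem mink_unitNormal_fderiv (X : R3 → R4) (u w : R3) :
    mink (unitNormal X u) (fderiv ℝ X u w) = 0 := by
  rw [fderiv_eq_partialX, unitNormal, mink_smul_left, mink_add_right, mink_add_right,
    mink_smul_right, mink_smul_right, mink_smul_right, mink_wedge_left, mink_wedge_middle,
    mink_wedge_right]
  ring

theorem IsSpacelikeEmbedding.contDiffOn_unitNormal (hX : IsSpacelikeEmbedding U X) :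
    ContDiffOn ℝ ∞ (unitNormal X) U := by
  have hp : ∀ i, ContDiffOn ℝ ∞ (partialX X i) U := fun i =>
    (hX.contDiffOn.fderiv_of_isOpen hX.isOpen (by simp)).clm_apply contDiffOn_const
  have hw := (hp 0).wedge (hp 1) (hp 2)
  have hn : ContDiffOn ℝ ∞ (fun u => mnorm (wedge (partialX X 0 u) (partialX X 1 u)
      (partialX X 2 u))) U := by
    refine ((hw.mink hw).neg.sqrt fun u hu => (neg_pos.2 (hX.wedge_partialX_neg hu)).ne').congr
      fun u hu => ?_
    rw [mnorm, abs_of_neg (hX.wedge_partialX_neg hu)]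
  refine (hn.inv fun u hu => ?_).smul hw
  rw [mnorm, abs_of_neg (hX.wedge_partialX_neg hu)]
  exact (Real.sqrt_pos.2 (neg_pos.2 (hX.wedge_partialX_neg hu))).ne'

end Hypersurface

/-! ### Adapted frames -/

/-- A smooth pseudo-orthonormal frame `n, t, a, b` over `I` with `n` timelike, whose vector `t` has
derivative `κ n + κ' a`. -/
structure IsAdaptedFrame (I : Set ℝ) (n t a b : ℝ → R4) (κ κ' : ℝ → ℝ) : Prop where
  contDiffOn_n : ContDiffOn ℝ ∞ n I
  contDiffOn_t : ContDiffOn ℝ ∞ t I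
  contDiffOn_a : ContDiffOn ℝ ∞ a I
  contDiffOn_b : ContDiffOn ℝ ∞ b I
  contDiffOn_κ : ContDiffOn ℝ ∞ κ I
  contDiffOn_κ' : ContDiffOn ℝ ∞ κ' I
  nn : ∀ s ∈ I, mink (n s) (n s) = -1
  tt : ∀ s ∈ I, mink (t s) (t s) = 1
  aa : ∀ s ∈ I, mink (a s) (a s) = 1
  bb : ∀ s ∈ I, mink (b s) (b s) = 1
  nt : ∀ s ∈ I, mink (n s) (t s) = 0
  na : ∀ s ∈ I, mink (n s) (a s) = 0
  nb : ∀ s ∈ I, mink (n s) (b s) = 0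
  ta : ∀ s ∈ I, mink (t s) (a s) = 0
  tb : ∀ s ∈ I, mink (t s) (b s) = 0
  ab : ∀ s ∈ I, mink (a s) (b s) = 0
  deriv_t : ∀ s ∈ I, deriv t s = κ s • n s + κ' s • a s

theorem isAdaptedFrame {U : Set R3} {X : R3 → R4} (hX : IsSpacelikeEmbedding U X) {I : Set ℝ}
    (hI : IsOpen I) {γb : ℝ → R3} (hγ : ContDiffOn ℝ ∞ γb I) (hγU : ∀ s ∈ I, γb s ∈ U)
    (hunit : ∀ s ∈ I, mink (tang X γb s) (tang X γb s) = 1) (hkg : ∀ s ∈ I, kg X γb s ≠ 0) :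
    IsAdaptedFrame I (nG X γb) (tang X γb) (n1 X γb) (n2 X γb) (kn X γb) (kg X γb) := by
  have hc : ContDiffOn ℝ ∞ (curve X γb) I := hX.contDiffOn.comp hγ hγU
  have ht : ContDiffOn ℝ ∞ (tang X γb) I := hc.deriv_of_isOpen hI (by simp)
  have ht' : ContDiffOn ℝ ∞ (deriv (tang X γb)) I := ht.deriv_of_isOpen hI (by simp)
  have hn : ContDiffOn ℝ ∞ (nG X γb) I := hX.contDiffOn_unitNormal.comp hγ hγU
  have hg : ContDiffOn ℝ ∞ (geodVec X γb) I := ((hn.mink ht').smul hn).add ht'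
  have nn : ∀ s ∈ I, mink (nG X γb s) (nG X γb s) = -1 := fun s hs =>
    hX.mink_unitNormal (hγU s hs)
  have nt : ∀ s ∈ I, mink (nG X γb s) (tang X γb s) = 0 := fun s hs => by
    have h1 : HasFDerivAt X (fderiv ℝ X (γb s)) (γb s) :=
      ((hX.contDiffOn.contDiffAt (hX.isOpen.mem_nhds (hγU s hs))).differentiableAt
        (by simp)).hasFDerivAt
    have h2 : HasDerivAt γb (deriv γb s) s :=
      ((hγ.contDiffAt (hI.mem_nhds hs)).differentiableAt (by simp)).hasDerivAt
    have h3 : tang X γb s = fderiv ℝ X (γb s) (deriv γb s) := (h1.comp_hasDerivAt s h2).deriv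
    rw [h3]
    exact mink_unitNormal_fderiv X _ _
  have tt' : ∀ s ∈ I, mink (deriv (tang X γb) s) (tang X γb s) = 0 := fun s hs => by
    have hd := (ht.contDiffAt (hI.mem_nhds hs)).differentiableAt (by simp)
    have := mink_deriv_left_eq_neg hd hd
      (Filter.eventually_of_mem (hI.mem_nhds hs) hunit)
    rw [mink_comm (tang X γb s)] at this
    linarith
  have gn : ∀ s ∈ I, mink (geodVec X γb s) (nG X γb s) = 0 := fun s hs => by
    rw [geodVec, mink_add_left, mink_smul_left, nn s hs, mink_comm (deriv _ s)]
    ring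
  have gt : ∀ s ∈ I, mink (geodVec X γb s) (tang X γb s) = 0 := fun s hs => by
    rw [geodVec, mink_add_left, mink_smul_left, nt s hs, tt' s hs]
    ring
  have gg : ∀ s ∈ I, 0 < mink (geodVec X γb s) (geodVec X γb s) := fun s hs => by
    refine lt_of_le_of_ne (mink_self_nonneg_of_orthogonal (nn s hs) (gn s hs)) fun h => ?_
    refine hkg s hs ?_
    rw [kg, mnorm, ← h]
    simp
  have kg_eq : ∀ s ∈ I, kg X γb s = √(mink (geodVec X γb s) (geodVec X γb s)) := fun s hs => by
    rw [kg, mnorm, abs_of_pos (gg s hs)]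
  have hkgs : ContDiffOn ℝ ∞ (kg X γb) I :=
    ((hg.mink hg).sqrt fun s hs => (gg s hs).ne').congr kg_eq
  have ha : ContDiffOn ℝ ∞ (n1 X γb) I := (hkgs.inv hkg).smul hg
  have na : ∀ s ∈ I, mink (nG X γb s) (n1 X γb s) = 0 := fun s hs => by
    rw [n1, mink_smul_right, mink_comm, gn s hs, mul_zero]
  have ta : ∀ s ∈ I, mink (tang X γb s) (n1 X γb s) = 0 := fun s hs => by
    rw [n1, mink_smul_right, mink_comm, gt s hs, mul_zero]
  have aa : ∀ s ∈ I, mink (n1 X γb s) (n1 X γb s) = 1 := fun s hs => by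
    have h1 : mink (geodVec X γb s) (geodVec X γb s) = kg X γb s ^ 2 := by
      rw [kg_eq s hs, Real.sq_sqrt (gg s hs).le]
    have := hkg s hs
    rw [n1, mink_smul_left, mink_smul_right, h1]
    field_simp
  refine ⟨hn, ht, ha, hn.wedge ht ha, (hn.mink ht').neg, hkgs, nn, hunit, aa, fun s hs => ?_, nt,
    na, fun s hs => ?_, ta, fun s hs => ?_, fun s hs => ?_, fun s hs => ?_⟩
  · rw [n2, mink_wedge_self, nn s hs, hunit s hs, aa s hs, nt s hs, na s hs, ta s hs]
    norm_num
  · rw [mink_comm]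
    exact mink_wedge_left _ _ _
  · rw [mink_comm]
    exact mink_wedge_middle _ _ _
  · rw [mink_comm]
    exact mink_wedge_right _ _ _
  · rw [n1, smul_smul, mul_inv_cancel₀ (hkg s hs), one_smul, geodVec, kn, neg_smul]
    abel

/-- The direction of the dual curve of `t`. For `σ = ⟨t'', b⟩` and
`l = κ' κ₁ + κ' ^ 2 τ - κ ^ 2 τ - κ κ'₁`, where `κ₁`, `κ'₁` are the derivatives of `κ`, `κ'` and
`τ = ⟨a, n'⟩`, it spans the orthogonal complement of `t`, `t'` and `t''`. -/
def dualDir (n a b : ℝ → R4) (κ κ' l σ : ℝ → ℝ) (s : ℝ) : R4 :=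
  κ' s • n s + κ s • a s + (l s / σ s) • b s

section AdaptedFrame

variable {I : Set ℝ} {n t a b : ℝ → R4} {κ κ' : ℝ → ℝ} (hF : IsAdaptedFrame I n t a b κ κ')
include hF

/-- The components of `t''` in the frame. -/
theorem IsAdaptedFrame.mink_deriv_deriv_t (hI : IsOpen I) {s : ℝ} (hs : s ∈ I) :
    mink (deriv (deriv t) s) (n s) = -deriv κ s - κ' s * mink (a s) (deriv n s) ∧
    mink (deriv (deriv t) s) (a s) = κ s * mink (a s) (deriv n s) + deriv κ' s ∧
    mink (deriv (deriv t) s) (b s) =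
      κ s * mink (b s) (deriv n s) + κ' s * mink (-deriv b s) (a s) := by
  have hd : ∀ {f : ℝ → R4}, ContDiffOn ℝ ∞ f I → DifferentiableAt ℝ f s := fun hf =>
    (hf.contDiffAt (hI.mem_nhds hs)).differentiableAt (by simp)
  have hd' : ∀ {f : ℝ → ℝ}, ContDiffOn ℝ ∞ f I → DifferentiableAt ℝ f s := fun hf =>
    (hf.contDiffAt (hI.mem_nhds hs)).differentiableAt (by simp)
  have hn := hd hF.contDiffOn_n
  have ha := hd hF.contDiffOn_a
  have hb := hd hF.contDiffOn_b
  have hmem := hI.mem_nhds hs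
  have e : deriv (deriv t) s = κ s • deriv n s + deriv κ s • n s +
      (κ' s • deriv a s + deriv κ' s • a s) := by
    have h1 : deriv t =ᶠ[𝓝 s] fun s => κ s • n s + κ' s • a s :=
      Filter.eventually_of_mem hmem hF.deriv_t
    rw [h1.deriv_eq]
    exact (((hd' hF.contDiffOn_κ).hasDerivAt.fun_smul hn.hasDerivAt).fun_add
      ((hd' hF.contDiffOn_κ').hasDerivAt.fun_smul ha.hasDerivAt)).deriv
  have nn := mink_deriv_left_eq_neg hn hn (Filter.eventually_of_mem hmem hF.nn)
  have aa := mink_deriv_left_eq_neg ha ha (Filter.eventually_of_mem hmem hF.aa)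
  have na := mink_deriv_left_eq_neg hn ha (Filter.eventually_of_mem hmem hF.na)
  have ab := mink_deriv_left_eq_neg ha hb (Filter.eventually_of_mem hmem hF.ab)
  rw [mink_comm (n s)] at nn
  rw [mink_comm (a s)] at aa
  have nn' : mink (deriv n s) (n s) = 0 := by linarith
  have aa' : mink (deriv a s) (a s) = 0 := by linarith
  refine ⟨?_, ?_, ?_⟩
  · rw [e]
    simp only [mink_add_left, mink_smul_left, nn', hF.nn s hs, mink_comm (a s) (n s), hF.na s hs]
    rw [mink_comm (a s), na, mink_comm (n s)]
    ring
  · rw [e]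
    simp only [mink_add_left, mink_smul_left, aa', hF.aa s hs, hF.na s hs]
    rw [mink_comm (a s) (deriv n s)]
    ring
  · rw [e]
    simp only [mink_add_left, mink_smul_left, hF.nb s hs, hF.ab s hs, ab, mink_neg_left]
    rw [mink_comm (b s), mink_comm (a s)]
    ring

variable {l σ : ℝ → ℝ}

theorem IsAdaptedFrame.mink_dualDir_self {s : ℝ} (hs : s ∈ I) :
    mink (dualDir n a b κ κ' l σ s) (dualDir n a b κ κ' l σ s) =
      κ s ^ 2 - κ' s ^ 2 + (l s / σ s) ^ 2 := by
  simp only [dualDir, mink_add_left, mink_add_right, mink_smul_left, mink_smul_right,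
    mink_comm (a s) (n s), mink_comm (b s) (n s), mink_comm (b s) (a s), hF.nn s hs, hF.aa s hs,
    hF.bb s hs, hF.na s hs, hF.nb s hs, hF.ab s hs]
  ring

theorem IsAdaptedFrame.mink_dualDir_self_pos {s : ℝ} (hs : s ∈ I) (hk : κ' s ^ 2 < κ s ^ 2) :
    0 < mink (dualDir n a b κ κ' l σ s) (dualDir n a b κ κ' l σ s) := by
  rw [hF.mink_dualDir_self hs]
  have := sq_nonneg (l s / σ s)
  linarith

theorem IsAdaptedFrame.mink_dualDir_t {s : ℝ} (hs : s ∈ I) :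
    mink (dualDir n a b κ κ' l σ s) (t s) = 0 := by
  simp only [dualDir, mink_add_left, mink_smul_left, mink_comm (a s) (t s), mink_comm (b s) (t s),
    hF.nt s hs, hF.ta s hs, hF.tb s hs]
  ring

theorem IsAdaptedFrame.mink_dualDir_deriv_t {s : ℝ} (hs : s ∈ I) :
    mink (dualDir n a b κ κ' l σ s) (deriv t s) = 0 := by
  rw [hF.deriv_t s hs]
  simp only [dualDir, mink_add_left, mink_smul_left, mink_add_right, mink_smul_right,
    mink_comm (a s) (n s), mink_comm (b s) (n s), mink_comm (b s) (a s), hF.nn s hs, hF.aa s hs,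
    hF.na s hs, hF.nb s hs, hF.ab s hs]
  ring

theorem IsAdaptedFrame.mink_dualDir_deriv_deriv_t (hI : IsOpen I) {s : ℝ} (hs : s ∈ I)
    (hσ : σ s = κ s * mink (b s) (deriv n s) + κ' s * mink (-deriv b s) (a s))
    (hl : l s = κ' s * deriv κ s + κ' s ^ 2 * mink (a s) (deriv n s)
      - κ s ^ 2 * mink (a s) (deriv n s) - κ s * deriv κ' s) (hσ0 : σ s ≠ 0) :
    mink (dualDir n a b κ κ' l σ s) (deriv (deriv t) s) = 0 := by
  obtain ⟨h1, h2, h3⟩ := hF.mink_deriv_deriv_t hI hs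
  rw [← hσ] at h3
  rw [mink_comm]
  simp only [dualDir, mink_add_right, mink_smul_right, h1, h2, h3, div_mul_cancel₀ _ hσ0, hl]
  ring

/-- The orthogonal complement of `t`, `t'` and `t''` is a line; this is where `σ ≠ 0` enters. -/
theorem IsAdaptedFrame.eq_smul_dualDir (hI : IsOpen I) {s : ℝ} (hs : s ∈ I)
    (hσ : σ s = κ s * mink (b s) (deriv n s) + κ' s * mink (-deriv b s) (a s))
    (hl : l s = κ' s * deriv κ s + κ' s ^ 2 * mink (a s) (deriv n s)
      - κ s ^ 2 * mink (a s) (deriv n s) - κ s * deriv κ' s) (hσ0 : σ s ≠ 0) (hκ' : κ' s ≠ 0)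
    {x : R4} (h0 : mink x (t s) = 0) (h1 : mink x (deriv t s) = 0)
    (h2 : mink x (deriv (deriv t) s) = 0) : ∃ ρ : ℝ, x = ρ • dualDir n a b κ κ' l σ s := by
  obtain ⟨e1, e2, e3⟩ := hF.mink_deriv_deriv_t hI hs
  rw [← hσ] at e3
  have hx := eq_frame_expansion (hF.nn s hs) (hF.tt s hs) (hF.aa s hs) (hF.bb s hs) (hF.nt s hs)
    (hF.na s hs) (hF.nb s hs) (hF.ta s hs) (hF.tb s hs) (hF.ab s hs) x
  rw [h0, zero_smul, add_zero] at hx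
  rw [hF.deriv_t s hs, mink_add_right, mink_smul_right, mink_smul_right] at h1
  rw [hx, mink_comm] at h2
  simp only [mink_add_right, mink_smul_right, e1, e2, e3] at h2
  have ha : mink x (a s) = -mink x (n s) / κ' s * κ s := by
    field_simp
    linarith
  have hb : mink x (b s) = -mink x (n s) / κ' s * (l s / σ s) := by
    rw [ha] at h2
    field_simp
    field_simp at h2
    rw [hl]
    linear_combination h2
  refine ⟨-mink x (n s) / κ' s, ?_⟩
  rw [dualDir, smul_add, smul_add, smul_smul, smul_smul, smul_smul, ← ha, ← hb,
    div_mul_cancel₀ _ hκ']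
  exact hx

end AdaptedFrame

theorem deriv_mink_const {f : ℝ → R4} (hf : ContDiff ℝ ∞ f) (v : R4) :
    deriv (fun s => mink (f s) v) = fun s => mink (deriv f s) v := by
  funext s
  have h := ((hf.differentiable (by simp) s).hasDerivAt.mink (hasDerivAt_const s v)).deriv
  rw [h, mink_comm (f s), mink_zero_left, add_zero]

/-! ### Dual curves in the de Sitter space -/

/-- Near `s₀`, the curve `α` in the de Sitter space is orthogonal to `t`, `t'` and `t''`; at `s₀`
these four vectors span the space. -/
structure IsDualCurve (α t : ℝ → R4) (s₀ : ℝ) : Prop where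
  contDiff_α : ContDiff ℝ ∞ α
  contDiff_t : ContDiff ℝ ∞ t
  self : ∀ᶠ s in 𝓝 s₀, mink (α s) (α s) = 1
  zero : ∀ᶠ s in 𝓝 s₀, mink (α s) (t s) = 0
  one : ∀ᶠ s in 𝓝 s₀, mink (α s) (deriv t s) = 0
  two : ∀ᶠ s in 𝓝 s₀, mink (α s) (deriv (deriv t) s) = 0
  nondegenerate : ∀ x, mink x (t s₀) = 0 → mink x (deriv t s₀) = 0 →
    mink x (deriv (deriv t) s₀) = 0 → mink x (α s₀) = 0 → x = 0

section DualCurve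

variable {α t : ℝ → R4} {s₀ : ℝ} (h : IsDualCurve α t s₀)
include h

/-- The derivative of a dual curve, tested against `t`, `t'` and `t''`. -/
theorem IsDualCurve.mink_deriv :
    (∀ᶠ s in 𝓝 s₀, mink (deriv α s) (t s) = 0) ∧
    (∀ᶠ s in 𝓝 s₀, mink (deriv α s) (deriv t s) = 0) ∧
    (∀ᶠ s in 𝓝 s₀, mink (deriv α s) (deriv (deriv t) s) =
      -mink (α s) (deriv (deriv (deriv t)) s)) := by
  have ha := h.contDiff_α
  have h0 := h.contDiff_t
  have h1 := (contDiff_infty_iff_deriv.1 h0).2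
  have h2 := (contDiff_infty_iff_deriv.1 h1).2
  have hd : ∀ {f : ℝ → R4}, ContDiff ℝ ∞ f → Differentiable ℝ f := fun hf =>
    hf.differentiable (by simp)
  refine ⟨?_, ?_, ?_⟩
  · filter_upwards [h.zero.eventually_nhds, h.one] with s e1 e2
    rw [mink_deriv_left_eq_neg (hd ha s) (hd h0 s) e1, e2, neg_zero]
  · filter_upwards [h.one.eventually_nhds, h.two] with s e1 e2
    rw [mink_deriv_left_eq_neg (hd ha s) (hd h1 s) e1, e2, neg_zero]
  · filter_upwards [h.two.eventually_nhds] with s e1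
    rw [mink_deriv_left_eq_neg (hd ha s) (hd h2 s) e1]

/-- If `⟨α, t'''⟩ ≠ 0` at `s₀`, the component of `α` along `t''(s₀)` is regular there, and `α` is
locally diffeomorphic to a line. -/
theorem IsDualCurve.isLocallyDiffeo_lineCurve {I : Set ℝ} (hI : IsOpen I) (hs₀ : s₀ ∈ I)
    {α' : ℝ → R4} (hα' : ∀ s ∈ I, α' s ∈ deSitter) (hαc : ContinuousOn α' I)
    (he : α =ᶠ[𝓝 s₀] α') (h3 : mink (α s₀) (deriv (deriv (deriv t)) s₀) ≠ 0) :
    IsLocallyDiffeoToCurve deSitter I α' s₀ lineCurve := by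
  have ha := h.contDiff_α
  let p : Fin 3 → R4 := ![deriv (deriv t) s₀, deriv t s₀, t s₀]
  have hp : ∀ i, mink (α s₀) (p i) = 0 := fun i => by
    fin_cases i
    · exact h.two.self_of_nhds
    · exact h.one.self_of_nhds
    · exact h.zero.self_of_nhds
  have hc : ContDiff ℝ ∞ fun s => (fun i => mink (α s) (p i) : R3) :=
    contDiff_pi.2 fun i => ha.mink contDiff_const
  refine isLocallyDiffeoToCurve_of_isGermEquivalent hI hs₀ hα' hαc p
    (fun i => by rw [← he.self_of_nhds]; exact hp i) (fun x hx hxa => ?_)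
    (c := fun s i => mink (α s) (p i)) ?_ continuous_lineCurve ?_
    (fun ε _ => lineCurve_mem_iff ε) (isGermEquivalent_lineCurve hc (funext hp) ?_)
  · rw [← he.self_of_nhds] at hxa
    exact h.nondegenerate x (hx 2) (hx 1) (hx 0) hxa
  · filter_upwards [he] with s hs
    rw [hs]
  · exact vec3_ext rfl rfl rfl
  · rw [deriv_mink_const ha]
    change mink (deriv α s₀) (deriv (deriv t) s₀) ≠ 0
    rw [h.mink_deriv.2.2.self_of_nhds]
    exact neg_ne_zero.2 h3

/-- If `⟨α, t'''⟩ = 0 ≠ ⟨α, t''''⟩` at `s₀`, then `α` is singular there; its second derivative is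
orthogonal to `t` and `t'` but not to `t''`, and its third derivative is not orthogonal to `t'`. -/
theorem IsDualCurve.isLocallyDiffeo_cusp234 {I : Set ℝ} (hI : IsOpen I) (hs₀ : s₀ ∈ I)
    {α' : ℝ → R4} (hα' : ∀ s ∈ I, α' s ∈ deSitter) (hαc : ContinuousOn α' I)
    (he : α =ᶠ[𝓝 s₀] α') (h3 : mink (α s₀) (deriv (deriv (deriv t)) s₀) = 0)
    (h4 : mink (α s₀) (deriv (deriv (deriv (deriv t))) s₀) ≠ 0) :
    IsLocallyDiffeoToCurve deSitter I α' s₀ cusp234 := by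
  have ha := h.contDiff_α
  have ha1 := (contDiff_infty_iff_deriv.1 ha).2
  have ha2 := (contDiff_infty_iff_deriv.1 ha1).2
  have ht := h.contDiff_t
  have ht1 := (contDiff_infty_iff_deriv.1 ht).2
  have ht2 := (contDiff_infty_iff_deriv.1 ht1).2
  have ht3 := (contDiff_infty_iff_deriv.1 ht2).2
  have hd : ∀ {f : ℝ → R4}, ContDiff ℝ ∞ f → Differentiable ℝ f := fun hf =>
    hf.differentiable (by simp)
  obtain ⟨e0, e1, e2⟩ := h.mink_deriv
  have hα1 : deriv α s₀ = 0 := by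
    refine h.nondegenerate _ e0.self_of_nhds e1.self_of_nhds ?_ ?_
    · rw [e2.self_of_nhds, h3, neg_zero]
    · have := mink_deriv_left_eq_neg (hd ha s₀) (hd ha s₀) h.self
      rw [mink_comm (α s₀)] at this
      linarith
  set m := mink (α s₀) (deriv (deriv (deriv (deriv t))) s₀) with hm
  have e21 : ∀ᶠ s in 𝓝 s₀, mink (deriv (deriv α) s) (deriv t s) =
      mink (α s) (deriv (deriv (deriv t)) s) := by
    filter_upwards [e1.eventually_nhds, e2] with s h1 h2
    rw [mink_deriv_left_eq_neg (hd ha1 s) (hd ht1 s) h1, h2, neg_neg]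
  have e22 : mink (deriv (deriv α) s₀) (deriv (deriv t) s₀) = -m := by
    have hL := (hd ha1 s₀).hasDerivAt.mink (hd ht2 s₀).hasDerivAt
    have hR := ((hd ha s₀).hasDerivAt.mink (hd ht3 s₀).hasDerivAt).fun_neg
    have := (hL.congr_of_eventuallyEq (e2.mono fun s hs => hs.symm)).unique hR
    rw [hα1, mink_zero_left, ← hm] at this
    linarith
  have e31 : mink (deriv (deriv (deriv α)) s₀) (deriv t s₀) = 2 * m := by
    have hL := (hd ha2 s₀).hasDerivAt.mink (hd ht1 s₀).hasDerivAt
    have hR := (hd ha s₀).hasDerivAt.mink (hd ht3 s₀).hasDerivAt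
    have := (hL.congr_of_eventuallyEq (e21.mono fun s hs => hs.symm)).unique hR
    rw [hα1, mink_zero_left, ← hm, e22] at this
    linarith
  -- The factor makes the leading coefficient of the first component positive.
  let p : Fin 3 → R4 := ![(-m) • deriv (deriv t) s₀, deriv t s₀, t s₀]
  have hp : ∀ i, mink (α s₀) (p i) = 0 := fun i => by
    fin_cases i
    · change mink (α s₀) ((-m) • deriv (deriv t) s₀) = 0
      rw [mink_smul_right, h.two.self_of_nhds, mul_zero]
    · exact h.one.self_of_nhds
    · exact h.zero.self_of_nhds
  have hc : ContDiff ℝ ∞ fun s => (fun i => mink (α s) (p i) : R3) :=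
    contDiff_pi.2 fun i => ha.mink contDiff_const
  refine isLocallyDiffeoToCurve_of_isGermEquivalent hI hs₀ hα' hαc p
    (fun i => by rw [← he.self_of_nhds]; exact hp i) (fun x hx hxa => ?_)
    (c := fun s i => mink (α s) (p i)) ?_ continuous_cusp234 ?_
    (fun ε hε => cusp234_mem_iff hε) (isGermEquivalent_cusp234 hc (funext hp) (fun i => ?_) ?_ ?_ ?_)
  · rw [← he.self_of_nhds] at hxa
    refine h.nondegenerate x (hx 2) (hx 1) ?_ hxa
    have h0 : mink x ((-m) • deriv (deriv t) s₀) = 0 := hx 0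
    rw [mink_smul_right] at h0
    exact (mul_eq_zero.1 h0).resolve_left (neg_ne_zero.2 h4)
  · filter_upwards [he] with s hs
    rw [hs]
  · exact vec3_ext (by simp [cusp234]) (by simp [cusp234]) (by simp [cusp234])
  · rw [deriv_mink_const ha]
    change mink (deriv α s₀) (p i) = 0
    rw [hα1, mink_zero_left]
  · rw [iteratedDeriv_succ, iteratedDeriv_one, deriv_mink_const ha, deriv_mink_const ha1]
    change 0 < mink (deriv (deriv α) s₀) ((-m) • deriv (deriv t) s₀)
    rw [mink_smul_right, e22, neg_mul_neg]
    exact mul_self_pos.2 h4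
  · rw [iteratedDeriv_succ, iteratedDeriv_one, deriv_mink_const ha, deriv_mink_const ha1]
    exact e21.self_of_nhds.trans h3
  · rw [iteratedDeriv_succ, iteratedDeriv_succ, iteratedDeriv_one, deriv_mink_const ha,
      deriv_mink_const ha1, deriv_mink_const ha2]
    change mink (deriv (deriv (deriv α)) s₀) (deriv t s₀) ≠ 0
    rw [e31]
    exact mul_ne_zero two_ne_zero h4

end DualCurve

/-! ### Contact with slices -/

theorem isSubmersion_sliceFun {v : R4} (hv : v ∈ deSitter) (c : ℝ) :
    IsSubmersion (sliceFun v c) := by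
  refine ⟨(contDiff_id.mink contDiff_const).sub contDiff_const, fun x r => ?_⟩
  have h1 : HasFDerivAt (sliceFun v c) (minkForm v).toContinuousLinearMap x :=
    ((minkForm v).toContinuousLinearMap.hasFDerivAt (x := x)).sub_const c
  refine ⟨r • v, ?_⟩
  rw [h1.fderiv]
  change mink (r • v) v = r
  rw [mink_smul_left, show mink v v = 1 from hv, mul_one]

theorem iteratedDeriv_succ_sliceFun_curve {X : R3 → R4} {γb : ℝ → R3} {s₀ : ℝ}
    (h : ∀ᶠ s in 𝓝 s₀, DifferentiableAt ℝ (curve X γb) s) (v : R4) (c : ℝ) (j : ℕ) :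
    iteratedDeriv (j + 1) (sliceFun v c ∘ curve X γb) s₀ =
      iteratedDeriv j (heightS X γb v) s₀ := by
  rw [iteratedDeriv_succ']
  refine Filter.EventuallyEq.iteratedDeriv_eq j ?_
  filter_upwards [h] with s hs
  have h1 := (hs.hasDerivAt.mink (hasDerivAt_const s v)).sub_const c
  rw [mink_comm (curve X γb s), mink_zero_left, add_zero] at h1
  exact h1.deriv

theorem hasASingGE_succ_iff {g h : ℝ → ℝ} {s₀ : ℝ} (h0 : g s₀ = 0)
    (hgh : ∀ j, iteratedDeriv (j + 1) g s₀ = iteratedDeriv j h s₀) (k : ℕ) :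
    HasASingGE g s₀ (k + 1) ↔ HasASingGE h s₀ k := by
  constructor
  · intro hg j hj
    rw [← hgh]
    exact hg _ (by omega)
  · rintro hh (_ | j) hj
    · rwa [iteratedDeriv_zero]
    · rw [hgh]
      exact hh j (by omega)

theorem hasASing_succ_iff {g h : ℝ → ℝ} {s₀ : ℝ} (h0 : g s₀ = 0)
    (hgh : ∀ j, iteratedDeriv (j + 1) g s₀ = iteratedDeriv j h s₀) (k : ℕ) :
    HasASing g s₀ (k + 1) ↔ HasASing h s₀ k :=
  and_congr (hasASingGE_succ_iff h0 hgh k) (by rw [hgh])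

/-! ### De Sitter curves -/

section DeSitterCurve

variable {X : R3 → R4} {γb : ℝ → R3} {I : Set ℝ}

/-- The vector field `k_g n_γ + k_n n₁ + (λ₀ / (k_n τ₂ + k_g τ_g)) n₂`, of which the de Sitter
curves are the normalisations. -/
def deSitterDir (X : R3 → R4) (γb : ℝ → R3) : ℝ → R4 :=
  dualDir (nG X γb) (n1 X γb) (n2 X γb) (kn X γb) (kg X γb) (lambda0 X γb) (sigma X γb)

theorem deSitterSurface_mem
    (hF : IsAdaptedFrame I (nG X γb) (tang X γb) (n1 X γb) (n2 X γb) (kn X γb) (kg X γb)) {s : ℝ}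
    (hs : s ∈ I) (hk : kg X γb s ^ 2 < kn X γb s ^ 2) (θ : ℝ) :
    deSitterSurface X γb s θ ∈ deSitter := by
  change mink (deSitterSurface X γb s θ) (deSitterSurface X γb s θ) = 1
  have h1 := Real.sq_sqrt (sub_pos.2 hk).le
  have h2 := (Real.sqrt_pos.2 (sub_pos.2 hk)).ne'
  have h3 := Real.sin_sq_add_cos_sq θ
  simp only [deSitterSurface, mink_add_left, mink_add_right, mink_smul_left, mink_smul_right,
    mink_comm (n1 X γb s) (nG X γb s), mink_comm (n2 X γb s) (nG X γb s),
    mink_comm (n2 X γb s) (n1 X γb s), hF.nn s hs, hF.aa s hs, hF.bb s hs, hF.na s hs, hF.nb s hs,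
    hF.ab s hs]
  set r := √(kn X γb s ^ 2 - kg X γb s ^ 2)
  have h4 : (Real.cos θ / r) ^ 2 * (kn X γb s ^ 2 - kg X γb s ^ 2) = Real.cos θ ^ 2 := by
    rw [← h1]
    field_simp
  linear_combination h4 + h3

theorem deSitterCurve_eq_smul {θ : ℝ → ℝ} (hθ : IsDeSitterAngle X γb I θ) {s : ℝ} (hs : s ∈ I) :
    deSitterCurve X γb θ s =
      (Real.cos (θ s) / √(kn X γb s ^ 2 - kg X γb s ^ 2)) • deSitterDir X γb s := by
  have h1 := hθ.tan_eq s hs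
  rw [Real.tan_eq_sin_div_cos, div_eq_iff (hθ.cos_ne_zero s hs)] at h1
  rw [deSitterCurve, deSitterSurface, h1, deSitterDir, dualDir]
  simp only [smul_add, smul_smul]
  congr 2
  rw [div_mul_div_comm, div_mul_eq_mul_div, mul_comm (lambda0 X γb s),
    mul_comm (sigma X γb s)]

/-- A de Sitter curve is smooth near each point: it is a unit multiple of the smooth field
`deSitterDir`, and by continuity the sign of the factor is locally constant. -/
theorem exists_contDiffOn_deSitterCurve (hI : IsOpen I)
    (hF : IsAdaptedFrame I (nG X γb) (tang X γb) (n1 X γb) (n2 X γb) (kn X γb) (kg X γb))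
    (hk : ∀ s ∈ I, kg X γb s ^ 2 < kn X γb s ^ 2) (hw : ContDiffOn ℝ ∞ (deSitterDir X γb) I)
    {θ : ℝ → ℝ} (hθ : IsDeSitterAngle X γb I θ) {s₀ : ℝ} (hs₀ : s₀ ∈ I) :
    ∃ J, IsOpen J ∧ s₀ ∈ J ∧ ContDiffOn ℝ ∞ (deSitterCurve X γb θ) J := by
  set w := deSitterDir X γb with hwdef
  set m := fun s => Real.cos (θ s) / √(kn X γb s ^ 2 - kg X γb s ^ 2) with hm
  have hα : ∀ s ∈ I, deSitterCurve X γb θ s = m s • w s := fun s hs => deSitterCurve_eq_smul hθ hs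
  have hwp : ∀ s ∈ I, 0 < mink (w s) (w s) := fun s hs => hF.mink_dualDir_self_pos hs (hk s hs)
  have hm2 : ∀ s ∈ I, m s ^ 2 * mink (w s) (w s) = 1 := fun s hs => by
    have h1 : mink (deSitterCurve X γb θ s) (deSitterCurve X γb θ s) = 1 :=
      deSitterSurface_mem hF hs (hk s hs) _
    rw [hα s hs, mink_smul_left, mink_smul_right] at h1
    linarith
  have hm0 : ∀ s ∈ I, m s ≠ 0 := fun s hs h0 => by
    have := hm2 s hs
    rw [h0] at this
    norm_num at this
  have hww := hw.mink hw
  have hmc : ContinuousOn m I := by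
    have h1 : ContinuousOn (fun s => mink (deSitterCurve X γb θ s) (w s)) I :=
      (contDiff_mink (n := 0)).continuous.comp_continuousOn
        (hθ.continuousOn.prodMk hw.continuousOn)
    refine (h1.div hww.continuousOn fun s hs => (hwp s hs).ne').congr fun s hs => ?_
    change m s = mink (deSitterCurve X γb θ s) (w s) / mink (w s) (w s)
    rw [hα s hs, mink_smul_left, mul_div_cancel_right₀ _ (hwp s hs).ne']
  let J := I ∩ {s | 0 < m s * m s₀}
  have hJ : IsOpen J := (hmc.mul continuousOn_const).isOpen_inter_preimage hI isOpen_Ioi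
  have hr : ContDiffOn ℝ ∞ (fun s => (√(mink (w s) (w s)))⁻¹) I :=
    (hww.sqrt fun s hs => (hwp s hs).ne').inv fun s hs => (Real.sqrt_pos.2 (hwp s hs)).ne'
  have habs : ∀ s ∈ I, |m s| = (√(mink (w s) (w s)))⁻¹ := fun s hs => by
    rw [← Real.sqrt_inv, ← eq_inv_of_mul_eq_one_left (hm2 s hs), Real.sqrt_sq_eq_abs]
  have hmJ : ContDiffOn ℝ ∞ m J := by
    rcases lt_or_gt_of_ne (hm0 s₀ hs₀) with h0 | h0
    · have h1 : ∀ s ∈ J, m s < 0 := fun s hs => by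
        by_contra hc
        exact absurd hs.2 (mul_nonpos_of_nonneg_of_nonpos (not_lt.1 hc) h0.le).not_gt
      refine (hr.mono inter_subset_left).neg.congr fun s hs => ?_
      rw [← habs s hs.1, abs_of_neg (h1 s hs), neg_neg]
    · have h1 : ∀ s ∈ J, 0 < m s := fun s hs => pos_of_mul_pos_left hs.2 h0.le
      refine (hr.mono inter_subset_left).congr fun s hs => ?_
      rw [← habs s hs.1, abs_of_pos (h1 s hs)]
  exact ⟨J, hJ, ⟨hs₀, mul_self_pos.2 (hm0 s₀ hs₀)⟩,
    (hmJ.smul (hw.mono inter_subset_left)).congr fun s hs => hα s hs.1⟩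

theorem contDiffOn_deSitterDir (hI : IsOpen I)
    (hF : IsAdaptedFrame I (nG X γb) (tang X γb) (n1 X γb) (n2 X γb) (kn X γb) (kg X γb))
    (hσ : ∀ s ∈ I, sigma X γb s ≠ 0) : ContDiffOn ℝ ∞ (deSitterDir X γb) I := by
  have hd : ∀ {E : Type} [NormedAddCommGroup E] [NormedSpace ℝ E] {f : ℝ → E},
      ContDiffOn ℝ ∞ f I → ContDiffOn ℝ ∞ (deriv f) I := fun hf => hf.deriv_of_isOpen hI (by simp)
  have hκ := hF.contDiffOn_κ
  have hκ' := hF.contDiffOn_κ'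
  have h1 : ContDiffOn ℝ ∞ (tau1 X γb) I := hF.contDiffOn_a.mink (hd hF.contDiffOn_n)
  have h2 : ContDiffOn ℝ ∞ (tau2 X γb) I := hF.contDiffOn_b.mink (hd hF.contDiffOn_n)
  have h3 : ContDiffOn ℝ ∞ (taug X γb) I := (hd hF.contDiffOn_b).neg.mink hF.contDiffOn_a
  have hs : ContDiffOn ℝ ∞ (sigma X γb) I := (hκ.mul h2).add (hκ'.mul h3)
  have hl : ContDiffOn ℝ ∞ (lambda0 X γb) I :=
    (((hκ'.mul (hd hκ)).add ((hκ'.pow 2).mul h1)).sub ((hκ.pow 2).mul h1)).sub (hκ.mul (hd hκ'))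
  exact ((hκ'.smul hF.contDiffOn_n).add (hκ.smul hF.contDiffOn_a)).add
    ((hl.div hs hσ).smul hF.contDiffOn_b)

/-- The germ of a de Sitter curve is that of a dual curve of the tangent. -/
theorem exists_isDualCurve (hI : IsOpen I)
    (hF : IsAdaptedFrame I (nG X γb) (tang X γb) (n1 X γb) (n2 X γb) (kn X γb) (kg X γb))
    (hkg : ∀ s ∈ I, kg X γb s ≠ 0) (hσ : ∀ s ∈ I, sigma X γb s ≠ 0)
    (hk : ∀ s ∈ I, kg X γb s ^ 2 < kn X γb s ^ 2)
    {θ : ℝ → ℝ} (hθ : IsDeSitterAngle X γb I θ) {s₀ : ℝ} (hs₀ : s₀ ∈ I) :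
    ∃ α t : ℝ → R4, α =ᶠ[𝓝 s₀] deSitterCurve X γb θ ∧ t =ᶠ[𝓝 s₀] tang X γb ∧
      IsDualCurve α t s₀ := by
  obtain ⟨J, hJ, hsJ, hαJ⟩ := exists_contDiffOn_deSitterCurve hI hF hk
    (contDiffOn_deSitterDir hI hF hσ) hθ hs₀
  obtain ⟨α, hα, hαe⟩ := exists_contDiff_eventuallyEq hJ hsJ hαJ
  obtain ⟨t, ht, hte⟩ := exists_contDiff_eventuallyEq hI hs₀ hF.contDiffOn_t
  have hmem := hI.mem_nhds hs₀
  have h1 := hte.deriv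
  have h2 := h1.deriv
  refine ⟨α, t, hαe, hte, hα, ht, ?_, ?_, ?_, ?_, fun x e0 e1 e2 e3 => ?_⟩
  · filter_upwards [hαe, hmem] with s hs hsI
    rw [hs]
    exact deSitterSurface_mem hF hsI (hk s hsI) _
  · filter_upwards [hαe, hte, hmem] with s hs hs' hsI
    rw [hs, hs', deSitterCurve_eq_smul hθ hsI, mink_smul_left, deSitterDir,
      hF.mink_dualDir_t hsI, mul_zero]
  · filter_upwards [hαe, h1, hmem] with s hs hs' hsI
    rw [hs, hs', deSitterCurve_eq_smul hθ hsI, mink_smul_left, deSitterDir,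
      hF.mink_dualDir_deriv_t hsI, mul_zero]
  · filter_upwards [hαe, h2, hmem] with s hs hs' hsI
    rw [hs, hs', deSitterCurve_eq_smul hθ hsI, mink_smul_left, deSitterDir,
      hF.mink_dualDir_deriv_deriv_t hI hsI rfl rfl (hσ s hsI), mul_zero]
  · rw [hte.self_of_nhds] at e0
    rw [h1.self_of_nhds] at e1
    rw [h2.self_of_nhds] at e2
    obtain ⟨ρ, hρ⟩ := hF.eq_smul_dualDir (l := lambda0 X γb) (σ := sigma X γb) hI hs₀ rfl rfl
      (hσ s₀ hs₀) (hkg s₀ hs₀) e0 e1 e2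
    have hpos := hF.mink_dualDir_self_pos (l := lambda0 X γb) (σ := sigma X γb) hs₀ (hk s₀ hs₀)
    have hm : Real.cos (θ s₀) / √(kn X γb s₀ ^ 2 - kg X γb s₀ ^ 2) ≠ 0 :=
      div_ne_zero (hθ.cos_ne_zero s₀ hs₀) (Real.sqrt_pos.2 (sub_pos.2 (hk s₀ hs₀))).ne'
    rw [hρ, hαe.self_of_nhds, deSitterCurve_eq_smul hθ hs₀, mink_smul_left, mink_smul_right,
      deSitterDir] at e3
    have hρ0 : ρ = 0 := by
      rcases mul_eq_zero.1 e3 with h | h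
      · exact h
      · exact absurd h (mul_ne_zero hm hpos.ne')
    rw [hρ, hρ0, zero_smul]

end DeSitterCurve

theorem iteratedDeriv_heightS {X : R3 → R4} {γb : ℝ → R3} {t : ℝ → R4} (ht : ContDiff ℝ ∞ t)
    {s₀ : ℝ} (he : t =ᶠ[𝓝 s₀] tang X γb) (v : R4) (j : ℕ) :
    iteratedDeriv j (heightS X γb v) s₀ = mink (deriv^[j] t s₀) v := by
  have h1 : heightS X γb v =ᶠ[𝓝 s₀] fun s => mink (t s) v := by
    filter_upwards [he] with s hs
    rw [heightS, hs]
  rw [h1.iteratedDeriv_eq]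
  clear he h1
  induction j generalizing t with
  | zero => simp
  | succ j ih =>
    rw [iteratedDeriv_succ', deriv_mink_const ht, ih (contDiff_infty_iff_deriv.1 ht).2,
      Function.iterate_succ_apply]

/-- The unit normals of the slices in contact of order at least `3` are `± α`. -/
theorem IsDualCurve.exists_eq_smul {α t : ℝ → R4} {s₀ : ℝ} (h : IsDualCurve α t s₀) {v : R4}
    (hv : v ∈ deSitter) (h0 : mink (t s₀) v = 0) (h1 : mink (deriv t s₀) v = 0)
    (h2 : mink (deriv (deriv t) s₀) v = 0) : ∃ r : ℝ, r ≠ 0 ∧ v = r • α s₀ := by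
  have hvα : v = mink v (α s₀) • α s₀ := by
    rw [← sub_eq_zero]
    refine h.nondegenerate _ ?_ ?_ ?_ ?_
    · rw [mink_sub_left, mink_smul_left, h.zero.self_of_nhds, mink_comm, h0]; ring
    · rw [mink_sub_left, mink_smul_left, h.one.self_of_nhds, mink_comm, h1]; ring
    · rw [mink_sub_left, mink_smul_left, h.two.self_of_nhds, mink_comm, h2]; ring
    · rw [mink_sub_left, mink_smul_left, h.self.self_of_nhds]; ring
  refine ⟨_, fun h0 => ?_, hvα⟩
  rw [h0, zero_smul] at hvα
  have hv1 : mink v v = 1 := hv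
  rw [hvα, mink_zero_left] at hv1
  exact zero_ne_one hv1

end Mink

end

theorem proposition5p7
    (U : Set Mink.R3) (X : Mink.R3 → Mink.R4) (hX : Mink.IsSpacelikeEmbedding U X)
    (I : Set ℝ) (hI : IsOpen I) (hI' : I.OrdConnected)
    (γb : ℝ → Mink.R3) (hγ : ContDiffOn ℝ ∞ γb I) (hγU : ∀ s ∈ I, γb s ∈ U)
    (hunit : ∀ s ∈ I, Mink.mink (Mink.tang X γb s) (Mink.tang X γb s) = 1)
    (hkg : ∀ s ∈ I, Mink.kg X γb s ≠ 0)
    (hsigma : ∀ s ∈ I,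
      Mink.kn X γb s * Mink.tau2 X γb s + Mink.kg X γb s * Mink.taug X γb s ≠ 0)
    (hkn : ∀ s ∈ I, Mink.kg X γb s ^ 2 < Mink.kn X γb s ^ 2)
    (s₀ : ℝ) (hs₀ : s₀ ∈ I) (θ₀ : ℝ)
    (v₀ : Mink.R4) (hv₀ : v₀ = Mink.deSitterSurface X γb s₀ θ₀)
    (c : ℝ) (hc : c = Mink.mink (Mink.curve X γb s₀) v₀) :
    -- the slice is timelike, and `(h^S_t)_{v₀}` belongs to the family
    v₀ ∈ Mink.deSitter ∧
    -- contact of order at least 3 (through vanishing derivatives)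
    (Mink.HasContactOfOrderGE (Mink.sliceFun v₀ c) (Mink.curve X γb) s₀ 3 ↔
      Mink.HasASingGE (Mink.heightS X γb v₀) s₀ 2) ∧
    -- contact of some finite order `≥ 3`
    ((∃ k ≥ 3, Mink.HasContactOfOrder (Mink.sliceFun v₀ c) (Mink.curve X γb) s₀ k) ↔
      ∃ k ≥ 2, Mink.HasASing (Mink.heightS X γb v₀) s₀ k) ∧
    -- contact of order exactly 3
    (Mink.HasContactOfOrder (Mink.sliceFun v₀ c) (Mink.curve X γb) s₀ 3 →
      ∀ θ : ℝ → ℝ, Mink.IsDeSitterAngle X γb I θ →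
        Mink.IsLocallyDiffeoToCurve Mink.deSitter I (Mink.deSitterCurve X γb θ) s₀
          Mink.lineCurve) ∧
    -- contact of order exactly 4
    (Mink.HasContactOfOrder (Mink.sliceFun v₀ c) (Mink.curve X γb) s₀ 4 ↔
      Mink.HasASing (Mink.heightS X γb v₀) s₀ 3) ∧
    (Mink.HasContactOfOrder (Mink.sliceFun v₀ c) (Mink.curve X γb) s₀ 4 →
      Mink.lambda0 X γb s₀ ≠ 0 →
      ∀ θ : ℝ → ℝ, Mink.IsDeSitterAngle X γb I θ →
        Mink.IsLocallyDiffeoToCurve Mink.deSitter I (Mink.deSitterCurve X γb θ) s₀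
          Mink.cusp234) := by
  have hF := Mink.isAdaptedFrame hX hI hγ hγU hunit hkg
  have hvS : v₀ ∈ Mink.deSitter := by
    rw [hv₀]
    exact Mink.deSitterSurface_mem hF hs₀ (hkn s₀ hs₀) θ₀
  have hsub := Mink.isSubmersion_sliceFun hvS c
  have hcurve : ∀ᶠ s in 𝓝 s₀, DifferentiableAt ℝ (Mink.curve X γb) s := by
    filter_upwards [hI.mem_nhds hs₀] with s hs
    exact ((hX.contDiffOn.comp hγ hγU).contDiffAt (hI.mem_nhds hs)).differentiableAt (by simp)
  have hgh := Mink.iteratedDeriv_succ_sliceFun_curve hcurve v₀ c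
  have hg0 : (Mink.sliceFun v₀ c ∘ Mink.curve X γb) s₀ = 0 := by
    change Mink.mink (Mink.curve X γb s₀) v₀ - c = 0
    rw [hc, sub_self]
  have hA : ∀ k, Mink.HasContactOfOrder (Mink.sliceFun v₀ c) (Mink.curve X γb) s₀ (k + 1) ↔
      Mink.HasASing (Mink.heightS X γb v₀) s₀ k := fun k =>
    (and_iff_right hsub).trans (Mink.hasASing_succ_iff hg0 hgh k)
  have hmem : ∀ θ : ℝ → ℝ, ∀ s ∈ I, Mink.deSitterCurve X γb θ s ∈ Mink.deSitter := fun θ s hs =>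
    Mink.deSitterSurface_mem hF hs (hkn s hs) _
  refine ⟨hvS, (and_iff_right hsub).trans (Mink.hasASingGE_succ_iff hg0 hgh 2), ?_, ?_, hA 3, ?_⟩
  · constructor
    · rintro ⟨k, hk, h⟩
      obtain ⟨k, rfl⟩ : ∃ l, k = l + 1 := ⟨k - 1, by omega⟩
      exact ⟨k, by omega, (hA k).1 h⟩
    · rintro ⟨k, hk, h⟩
      exact ⟨k + 1, by omega, (hA k).2 h⟩
  · intro h θ hθ
    obtain ⟨α, t, hα, ht, hd⟩ := Mink.exists_isDualCurve hI hF hkg hsigma hkn hθ hs₀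
    obtain ⟨h0, h3⟩ := (hA 2).1 h
    simp only [Mink.iteratedDeriv_heightS hd.contDiff_t ht] at h0 h3
    obtain ⟨r, hr, hv⟩ := hd.exists_eq_smul hvS (h0 0 (by omega)) (h0 1 (by omega))
      (h0 2 (by omega))
    refine hd.isLocallyDiffeo_lineCurve hI hs₀ (hmem θ) hθ.continuousOn hα fun h => h3 ?_
    rw [hv, Mink.mink_smul_right, Mink.mink_comm]
    exact mul_eq_zero_of_right r h
  · intro h _ θ hθ
    obtain ⟨α, t, hα, ht, hd⟩ := Mink.exists_isDualCurve hI hF hkg hsigma hkn hθ hs₀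
    obtain ⟨h0, h4⟩ := (hA 3).1 h
    simp only [Mink.iteratedDeriv_heightS hd.contDiff_t ht] at h0 h4
    obtain ⟨r, hr, hv⟩ := hd.exists_eq_smul hvS (h0 0 (by omega)) (h0 1 (by omega))
      (h0 2 (by omega))
    have h3 := h0 3 le_rfl
    rw [hv, Mink.mink_smul_right, Mink.mink_comm] at h3 h4
    exact hd.isLocallyDiffeo_cusp234 hI hs₀ (hmem θ) hθ.continuousOn hα
      ((mul_eq_zero.1 h3).resolve_left hr) (right_ne_zero_of_mul h4)
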